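/- Let $X$ be a topological space and $x_0\in X$. The first shape homotopy group is $\check\pi_1(X,x_0)=\varprojlim \pi_1(N(\mathcal U),\ast)$, where $(\mathcal U,\ast)$ ranges over the pointed normal covers of $(X,x_0)$, ordered by refinement: $\mathcal U$ is an open cover of $X$, $\ast\in\mathcal U$ is a designated member with $x_0\in\ast$, and $\mathcal U$ admits a subordinated locally finite partition of unity $(f_U)_{U\in\mathcal U}$ with $f_\ast(x_0)=1$; $N(\mathcal U)$ is the geometric realization (with the weak topology) of the nerve of $\mathcal U$, pointed at the vertex $\ast$; and if $(\mathcal V,\ast)$ refines $(\mathcal U,\ast)$, the bonding homomorphism is induced by any pointed simplicial map $N(\mathcal V)\to N(\mathcal U)$ that sends each vertex $V\in\mathcal V$ to a vertex $U\in\mathcal U$ with $V\subseteq U$. The natural homomorphism $\varphi:\pi_1(X,x_0)\to\check\pi_1(X,x_0)$ is $\varphi([\alpha])=([p_{\mathcal U}\circ\alpha])_{\mathcal U}$, where $p_{\mathcal U}:(X,x_0)\to(N(\mathcal U),\ast)$ is the map whose barycentric coordinates are such a partition of unity. The space $X$ is homotopically Hausdorff at $x_0$ if for every $g\in\pi_1(X,x_0)\setminus\{1\}$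 there is an open set $U\ni x_0$ such that no loop $\alpha$ in $U$ based at $x_0$ satisfies $[\alpha]=g$; it is homotopically Hausdorff if this holds at every one of its points. (1) For every topological space $X$ and every $x_0\in X$: if $\varphi:\pi_1(X,x_0)\to\check\pi_1(X,x_0)$ is injective, then $X$ is homotopically Hausdorff at $x_0$. (2) The converse need not hold. Let $$Y=\{(x,y,z)\in\mathbb R^3\mid z=0,\ 0<x\le 1,\ y=\sin(1/x)\}\cup(\{0\}\times[-1,1]\times\{0\}),$$ let $X\subseteq\mathbb R^3$ be obtained by revolving $Y$ about the $y$-axis, and let $x_0=(1,\sin 1,0)$. Then $X$ is homotopically Hausdorff, $\pi_1(X,x_0)$ is infinite cyclic, $\check\pi_1(X,x_0)$ is trivial, and $\varphi:\pi_1(X,x_0)\to\check\pi_1(X,x_0)$ is not injective. -/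

import Mathlib

open Set Topology

universe u

noncomputable section

/-! ### Geometric realization of an abstract simplicial complex -/

/-- The closed geometric simplex with vertex set `s` inside `ℝ^ι`: nonnegative barycentric
coordinates that vanish off `s` and sum to `1`. -/
def geomSimplex {ι : Type*} (s : Finset ι) : Set (ι → ℝ) :=
  {w | (∀ i, 0 ≤ w i) ∧ (∀ i, i ∉ s → w i = 0) ∧ ∑ i ∈ s, w i = 1}

/-- The underlying set of the geometric realization of `K`: the union of the closed geometric
simplices spanned by the faces of `K`. -/
@[ext]
structure Realization {ι : Type*} (K : PreAbstractSimplicialComplex ι) where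
  /-- the barycentric coordinates of the point -/
  bary : ι → ℝ
  mem : ∃ s ∈ K.faces, bary ∈ geomSimplex s

namespace Realization

variable {ι κ : Type*} {K : PreAbstractSimplicialComplex ι} {L : PreAbstractSimplicialComplex κ}

/-- The inclusion of the closed simplex spanned by a face. -/
def ofSimplex (K : PreAbstractSimplicialComplex ι) (s : K.faces) (w : geomSimplex s.1) :
    Realization K :=
  ⟨w.1, s.1, s.2, w.2⟩

/-- The weak (CW) topology: a set is open iff its intersection with every closed simplex is open
in that simplex. -/
instance : TopologicalSpace (Realization K) :=
  ⨆ s : K.faces, TopologicalSpace.coinduced (ofSimplex K s) inferInstance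

theorem continuous_ofSimplex (s : K.faces) : Continuous (ofSimplex K s) :=
  continuous_iff_coinduced_le.2
    (le_iSup (fun s : K.faces => TopologicalSpace.coinduced (ofSimplex K s) inferInstance) s)

theorem continuous_iff {T : Type*} [TopologicalSpace T] {f : Realization K → T} :
    Continuous f ↔ ∀ s : K.faces, Continuous (f ∘ ofSimplex K s) := by
  rw [continuous_iSup_dom]
  exact forall_congr' fun _ => continuous_coinduced_dom

theorem continuous_bary (i : ι) : Continuous fun b : Realization K => b.bary i :=
  continuous_iff.2 fun _ => (continuous_apply i).comp continuous_subtype_val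

theorem bary_nonneg (b : Realization K) (i : ι) : 0 ≤ b.bary i := by
  obtain ⟨s, _, h, _⟩ := b.mem
  exact h i

theorem finite_support (b : Realization K) : (Function.support b.bary).Finite := by
  obtain ⟨s, _, _, h, _⟩ := b.mem
  exact s.finite_toSet.subset fun i hi => by
    by_contra hn
    exact hi (h i hn)

theorem mem_geomSimplex (b : Realization K) {s : Finset ι} (h : ∀ i, i ∉ s → b.bary i = 0) :
    b.bary ∈ geomSimplex s := by
  classical
  refine ⟨b.bary_nonneg, h, ?_⟩
  obtain ⟨t, _, _, ht, h1⟩ := b.mem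
  rw [← h1]
  have e1 := Finset.sum_subset (f := b.bary) (Finset.subset_union_left (s₁ := s) (s₂ := t))
    fun i _ hi => h i hi
  have e2 := Finset.sum_subset (f := b.bary) (Finset.subset_union_right (s₁ := s) (s₂ := t))
    fun i _ hi => ht i hi
  rw [e1, e2]

/-- The set of vertices carrying positive weight at a point is a face. -/
theorem support_mem_faces (b : Realization K) : b.finite_support.toFinset ∈ K.faces := by
  obtain ⟨s, hs, _, h0, h1⟩ := b.mem
  refine (K.isRelLowerSet_faces hs).2 (fun i hi => ?_) ?_
  · by_contra hn
    exact (b.finite_support.mem_toFinset.1 hi) (h0 i hn)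
  · by_contra hn
    have : ∑ i ∈ s, b.bary i = 0 := Finset.sum_eq_zero fun i _ => by
      by_contra hi
      exact hn ⟨i, b.finite_support.mem_toFinset.2 hi⟩
    linarith

/-- A map into a geometric realization whose barycentric coordinates are continuous and have a
locally finite family of supports is continuous for the weak topology. -/
theorem continuous_of_locallyFinite {T : Type*} [TopologicalSpace T] {g : T → Realization K}
    (hc : ∀ i, Continuous fun t => (g t).bary i)
    (hf : LocallyFinite fun i => Function.support fun t => (g t).bary i) : Continuous g := by
  classical
  refine continuous_iff_continuousAt.2 fun t => ?_
  obtain ⟨N, hN, hfin⟩ := hf t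
  let F : Finset ι := hfin.toFinset
  let J : Set (Finset ι) := {s | s ∈ K.faces ∧ s ⊆ F}
  let A : Finset ι → Set T := fun s => {t' | ∀ i, i ∉ s → (g t').bary i = 0}
  have hJ : J.Finite := (F.powerset.finite_toSet).subset fun s hs => by
    simpa using hs.2
  have hA : ∀ s, IsClosed (A s) := fun s => by
    have : A s = ⋂ i, ⋂ (_ : i ∉ s), {t' | (g t').bary i = 0} := by
      ext; simp [A]
    rw [this]
    exact isClosed_iInter fun i => isClosed_iInter fun _ => isClosed_eq (hc i) continuous_const
  have hcov : (⋃ s ∈ J, A s) ∈ 𝓝 t := by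
    refine Filter.mem_of_superset hN fun t' ht' => ?_
    refine mem_iUnion₂.2 ⟨(g t').finite_support.toFinset,
      ⟨(g t').support_mem_faces, fun i hi => ?_⟩, fun i hi => ?_⟩
    · exact hfin.mem_toFinset.2 ⟨t', (g t').finite_support.mem_toFinset.1 hi, ht'⟩
    · by_contra h
      exact hi ((g t').finite_support.mem_toFinset.2 h)
  have hon : ∀ s ∈ J, ContinuousOn g (A s) := fun s hs => by
    rw [continuousOn_iff_continuous_domRestrict]
    have : (A s).domRestrict g = ofSimplex K ⟨s, hs.1⟩ ∘ fun t' : A s =>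
        (⟨(g t').bary, (g t').mem_geomSimplex t'.2⟩ : geomSimplex s) := rfl
    rw [this]
    refine (continuous_ofSimplex _).comp ?_
    exact Continuous.subtype_mk (continuous_pi fun i => (hc i).comp continuous_subtype_val) _
  have hw : ContinuousWithinAt g (⋃ s ∈ J, A s) t := by
    rw [ContinuousWithinAt, nhdsWithin_biUnion hJ]
    refine Filter.tendsto_iSup.2 fun s => Filter.tendsto_iSup.2 fun hs => ?_
    by_cases h : t ∈ A s
    · exact hon s hs t h
    · have : 𝓝[A s] t = ⊥ := by
        by_contra hb
        exact h ((hA s).closure_eq ▸ mem_closure_iff_nhdsWithin_neBot.2 ⟨hb⟩)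
      rw [this]
      exact Filter.tendsto_bot
  exact hw.continuousAt hcov

open Classical in
/-- The point of the geometric realization given by a vertex. -/
def vertex (K : PreAbstractSimplicialComplex ι) (v : ι) (hv : {v} ∈ K.faces) : Realization K :=
  ⟨Pi.single v 1, {v}, hv, fun i => by
      by_cases h : i = v
      · subst h; simp
      · simp [h],
    fun i hi => by simp_all, by simp⟩

theorem vertex_bary [DecidableEq ι] (K : PreAbstractSimplicialComplex ι) (v : ι)
    (hv : {v} ∈ K.faces) : (vertex K v hv).bary = Pi.single v 1 := by
  ext i
  by_cases h : i = v
  · subst h; simp [vertex]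
  · simp [vertex, h]

/-- The open star of a vertex. -/
def openStar (K : PreAbstractSimplicialComplex ι) (v : ι) : Set (Realization K) :=
  {b | 0 < b.bary v}

open Classical in
theorem push_eq_sum (r : ι → κ) {w : ι → ℝ} {s : Finset ι} (h0 : ∀ i, i ∉ s → w i = 0) (j : κ) :
    (∑ᶠ i, if r i = j then w i else 0) = ∑ i ∈ s, if r i = j then w i else 0 :=
  finsum_eq_sum_of_support_subset _ fun i hi => by
    by_contra hn
    have := h0 i hn
    simp [this] at hi

open Classical in
theorem push_mem_geomSimplex (r : ι → κ) {w : ι → ℝ} {s : Finset ι} (hw : w ∈ geomSimplex s) :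
    (fun j => ∑ᶠ i, if r i = j then w i else 0) ∈ geomSimplex (s.image r) := by
  obtain ⟨hn, h0, h1⟩ := hw
  refine ⟨fun j => finsum_nonneg fun i => ?_, fun j hj => ?_, ?_⟩
  · split_ifs
    exacts [hn i, le_rfl]
  · change (∑ᶠ i, if r i = j then w i else 0) = 0
    rw [push_eq_sum r h0]
    refine Finset.sum_eq_zero fun i hi => if_neg ?_
    rintro rfl
    exact hj (Finset.mem_image_of_mem r hi)
  · simp_rw [push_eq_sum r h0]
    rw [Finset.sum_comm, ← h1]
    refine Finset.sum_congr rfl fun i hi => ?_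
    rw [Finset.sum_ite_eq, if_pos (Finset.mem_image_of_mem r hi)]

open Classical in
/-- The map of geometric realizations that extends a simplicial vertex map `r` linearly over each
simplex: the weight of a vertex `j` is the sum of the weights of the vertices sent to `j`. -/
def simplicialMap (r : ι → κ) (hr : ∀ s ∈ K.faces, ∀ t : Finset κ, (t : Set κ) = r '' s → t ∈ L.faces) :
    C(Realization K, Realization L) where
  toFun b := ⟨fun j => ∑ᶠ i, if r i = j then b.bary i else 0, by
    obtain ⟨s, hs, hw⟩ := b.mem
    exact ⟨s.image r, hr s hs _ Finset.coe_image, push_mem_geomSimplex r hw⟩⟩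
  continuous_toFun := continuous_iff.2 fun s =>
    (continuous_ofSimplex (K := L) ⟨s.1.image r, hr s.1 s.2 _ Finset.coe_image⟩).comp
      (f := fun w : geomSimplex s.1 => (⟨_, push_mem_geomSimplex r w.2⟩ : geomSimplex _)) <| by
      refine Continuous.subtype_mk (continuous_pi fun j => ?_) _
      simp_rw [fun w : geomSimplex s.1 => push_eq_sum r w.2.2.1 j]
      refine continuous_finsetSum _ fun i _ => ?_
      split_ifs
      exacts [(continuous_apply i).comp continuous_subtype_val, continuous_const]

theorem exists_of_simplicialMap_ne_zero {r : ι → κ}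
    {hr : ∀ s ∈ K.faces, ∀ t : Finset κ, (t : Set κ) = r '' s → t ∈ L.faces} {b : Realization K} {j : κ}
    (h : (simplicialMap r hr b).bary j ≠ 0) : ∃ i, r i = j ∧ b.bary i ≠ 0 := by
  classical
  by_contra hn
  push Not at hn
  refine h ?_
  change (∑ᶠ i, if r i = j then b.bary i else 0) = 0
  refine finsum_eq_zero_of_forall_eq_zero fun i => ?_
  split_ifs with hi
  exacts [hn i hi, rfl]

theorem simplicialMap_vertex (r : ι → κ)
    (hr : ∀ s ∈ K.faces, ∀ t : Finset κ, (t : Set κ) = r '' s → t ∈ L.faces)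
    (v : ι) (hv : {v} ∈ K.faces) (hv' : {r v} ∈ L.faces) :
    simplicialMap r hr (vertex K v hv) = vertex L (r v) hv' := by
  classical
  ext j
  change (∑ᶠ i, if r i = j then (Pi.single v 1 : ι → ℝ) i else 0) = (Pi.single (r v) 1 : κ → ℝ) j
  rw [push_eq_sum r (s := {v}) (fun i hi => by simp_all)]
  by_cases h : r v = j
  · subst h; simp
  · simp [h, Ne.symm h]

end Realization

/-! ### Nerves of pointed normal covers -/

variable {X : Type u} [TopologicalSpace X]

/-- The nerve of a family of sets: the finite nonempty subfamilies with nonempty intersection. -/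
def nerve (𝒰 : Set (Set X)) : PreAbstractSimplicialComplex 𝒰 where
  faces := {s | s.Nonempty ∧ (⋂ U ∈ s, (U : Set X)).Nonempty}
  isRelLowerSet_faces := fun _ hs => ⟨hs.1, fun _ hts ht =>
    ⟨ht, hs.2.mono (biInter_subset_biInter_left hts)⟩⟩

/-- A pointed normal cover `(𝒰, ∗)` of `(X, x₀)`: an open cover `𝒰` with a designated member `∗`
containing `x₀` that admits a subordinated (locally finite) partition of unity whose associated
map to the nerve carries `x₀` to the vertex `∗`. If `X` is completely regular, then every open
cover with a subordinated partition of unity and every member `∗` containing `x₀` qualify. -/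
structure PointedNormalCover (x₀ : X) where
  /-- the members of the cover -/
  sets : Set (Set X)
  isOpen : ∀ U ∈ sets, IsOpen U
  sUnion_eq : ⋃₀ sets = univ
  /-- the designated member -/
  pt : sets
  mem_pt : x₀ ∈ (pt : Set X)
  normal : ∃ f : PartitionOfUnity sets X, f.IsSubordinate (fun U => (U : Set X)) ∧ f pt x₀ = 1

namespace PointedNormalCover

variable {x₀ : X}

theorem pt_mem_nerve (𝒰 : PointedNormalCover x₀) : {𝒰.pt} ∈ (nerve 𝒰.sets).faces :=
  ⟨Finset.singleton_nonempty _, x₀, by simpa using 𝒰.mem_pt⟩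

/-- The geometric realization `N(𝒰)` of the nerve. -/
abbrev N (𝒰 : PointedNormalCover x₀) : Type u := Realization (nerve 𝒰.sets)

/-- The distinguished vertex of the nerve. -/
def base (𝒰 : PointedNormalCover x₀) : 𝒰.N := Realization.vertex _ 𝒰.pt 𝒰.pt_mem_nerve

/-- A pointed refinement projection from `𝒱` to `𝒰`; such a map exists iff `(𝒱, ∗)` refines
`(𝒰, ∗)`. -/
structure Refinement (𝒱 𝒰 : PointedNormalCover x₀) where
  toFun : 𝒱.sets → 𝒰.sets
  subset : ∀ V : sets 𝒱, (V : Set X) ⊆ toFun V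
  map_pt : toFun 𝒱.pt = 𝒰.pt

variable {𝒰 𝒱 : PointedNormalCover x₀}

theorem Refinement.image_mem (r : Refinement 𝒱 𝒰) : ∀ s ∈ (nerve 𝒱.sets).faces,
    ∀ t : Finset 𝒰.sets, (t : Set 𝒰.sets) = r.toFun '' s → t ∈ (nerve 𝒰.sets).faces := by
  rintro s ⟨hs, x, hx⟩ t ht
  refine ⟨?_, x, mem_iInter₂.2 fun U hU => ?_⟩
  · rw [← Finset.coe_nonempty, ht]
    exact (Finset.coe_nonempty.2 hs).image _
  · obtain ⟨V, hV, rfl⟩ := ht ▸ Finset.mem_coe.2 hU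
    exact r.subset V (mem_iInter₂.1 hx V hV)

/-- The simplicial map `N(𝒱) → N(𝒰)` induced by a refinement projection. -/
def Refinement.map (r : Refinement 𝒱 𝒰) : C(𝒱.N, 𝒰.N) :=
  Realization.simplicialMap r.toFun r.image_mem

theorem Refinement.map_base (r : Refinement 𝒱 𝒰) : r.map 𝒱.base = 𝒰.base := by
  have h : {r.toFun 𝒱.pt} ∈ (nerve 𝒰.sets).faces := r.map_pt ▸ 𝒰.pt_mem_nerve
  refine (Realization.simplicialMap_vertex _ _ _ _ h).trans ?_
  simp only [base, r.map_pt]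

/-- The bonding homomorphism `π₁(N(𝒱), ∗) → π₁(N(𝒰), ∗)`. -/
def Refinement.hom (r : Refinement 𝒱 𝒰) :
    FundamentalGroup 𝒱.N 𝒱.base →* FundamentalGroup 𝒰.N 𝒰.base :=
  FundamentalGroup.mapOfEq r.map r.map_base

/-- A map `p : X → N(𝒰)` is canonical if it is pointed and the preimage of the open star of every
vertex is contained in the corresponding member of the cover. -/
structure IsCanonical (𝒰 : PointedNormalCover x₀) (p : C(X, 𝒰.N)) : Prop where
  map_base : p x₀ = 𝒰.base
  preimage_star : ∀ U : 𝒰.sets, p ⁻¹' Realization.openStar _ U ⊆ U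

/-- The map to the nerve whose barycentric coordinates are a subordinated partition of unity. -/
def partitionMap (𝒰 : PointedNormalCover x₀) (f : PartitionOfUnity 𝒰.sets X)
    (hf : f.IsSubordinate fun U => (U : Set X)) : C(X, 𝒰.N) where
  toFun x := ⟨fun U => f U x, f.finsupport x, by
    refine ⟨?_, x, mem_iInter₂.2 fun U hU => hf U (subset_tsupport _ ?_)⟩
    · obtain ⟨U, hU⟩ := f.exists_pos (mem_univ x)
      exact ⟨U, (f.mem_finsupport x).2 hU.ne'⟩
    · exact (f.mem_finsupport x).1 hU,
    fun U => f.nonneg U x,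
    fun U hU => by simpa using hU,
    f.sum_finsupport (mem_univ x)⟩
  continuous_toFun :=
    Realization.continuous_of_locallyFinite (fun U => (f U).continuous) f.locallyFinite

/-- The chosen canonical map `p_𝒰 : (X, x₀) → (N(𝒰), ∗)`, given by a partition of unity. -/
def canonicalMap (𝒰 : PointedNormalCover x₀) : C(X, 𝒰.N) :=
  𝒰.partitionMap 𝒰.normal.choose 𝒰.normal.choose_spec.1

theorem isCanonical_partitionMap (f : PartitionOfUnity 𝒰.sets X)
    (hf : f.IsSubordinate fun U => (U : Set X)) (h1 : f 𝒰.pt x₀ = 1) :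
    𝒰.IsCanonical (𝒰.partitionMap f hf) where
  map_base := by
    classical
    ext U
    rw [base, Realization.vertex_bary]
    change f U x₀ = _
    by_cases h : U = 𝒰.pt
    · subst h; simpa using h1
    · have h2 := f.sum_finsupport (mem_univ x₀)
      by_contra hn
      simp only [ne_eq, h, not_false_eq_true, Pi.single_eq_of_ne] at hn
      have hU : U ∈ f.finsupport x₀ := (f.mem_finsupport x₀).2 hn
      have hp : 𝒰.pt ∈ f.finsupport x₀ := (f.mem_finsupport x₀).2 (by simp [h1])
      have h3 := Finset.add_le_sum (f := fun U => f U x₀) (fun i _ => f.nonneg i x₀) hU hp h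
      have h4 := lt_of_le_of_ne (f.nonneg U x₀) (Ne.symm hn)
      simp only [h1] at h3
      linarith
  preimage_star U x hx := hf U (subset_tsupport _ (ne_of_gt hx))

theorem isCanonical_canonicalMap (𝒰 : PointedNormalCover x₀) : 𝒰.IsCanonical 𝒰.canonicalMap :=
  isCanonical_partitionMap _ _ 𝒰.normal.choose_spec.2

/-- The homomorphism `π₁(X, x₀) → π₁(N(𝒰), ∗)` induced by `p_𝒰`. -/
def canonicalHom (𝒰 : PointedNormalCover x₀) :
    FundamentalGroup X x₀ →* FundamentalGroup 𝒰.N 𝒰.base :=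
  FundamentalGroup.mapOfEq 𝒰.canonicalMap 𝒰.isCanonical_canonicalMap.map_base

/-- Two canonical maps with locally finite families of coordinate supports induce the same
homomorphism of fundamental groups, through the straight-line homotopy. -/
theorem mapOfEq_eq_of_isCanonical {p q : C(X, 𝒰.N)} (hp : 𝒰.IsCanonical p) (hq : 𝒰.IsCanonical q)
    (hpf : LocallyFinite fun U => Function.support fun x => (p x).bary U)
    (hqf : LocallyFinite fun U => Function.support fun x => (q x).bary U) :
    FundamentalGroup.mapOfEq p hp.map_base = FundamentalGroup.mapOfEq q hq.map_base := by
  classical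
  have hmem : ∀ z : unitInterval × X, ∃ s ∈ (nerve 𝒰.sets).faces,
      (fun U => (1 - (z.1 : ℝ)) * (p z.2).bary U + z.1 * (q z.2).bary U) ∈ geomSimplex s := by
    rintro ⟨t, x⟩
    let s := (p x).finite_support.toFinset ∪ (q x).finite_support.toFinset
    have hps : (p x).bary ∈ geomSimplex s := (p x).mem_geomSimplex fun i hi => by
      by_contra h
      exact hi (Finset.mem_union_left _ ((p x).finite_support.mem_toFinset.2 h))
    have hqs : (q x).bary ∈ geomSimplex s := (q x).mem_geomSimplex fun i hi => by
      by_contra h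
      exact hi (Finset.mem_union_right _ ((q x).finite_support.mem_toFinset.2 h))
    refine ⟨s, ⟨(p x).support_mem_faces.1.mono Finset.subset_union_left, x,
      mem_iInter₂.2 fun U hU => ?_⟩, fun i => ?_, fun i hi => ?_, ?_⟩
    · rcases Finset.mem_union.1 hU with h | h
      · exact hp.preimage_star U (lt_of_le_of_ne ((p x).bary_nonneg U)
          (Ne.symm ((p x).finite_support.mem_toFinset.1 h)))
      · exact hq.preimage_star U (lt_of_le_of_ne ((q x).bary_nonneg U)
          (Ne.symm ((q x).finite_support.mem_toFinset.1 h)))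
    · exact add_nonneg (mul_nonneg (sub_nonneg.2 t.2.2) (hps.1 i)) (mul_nonneg t.2.1 (hqs.1 i))
    · simp [hps.2.1 i hi, hqs.2.1 i hi]
    · rw [Finset.sum_add_distrib, ← Finset.mul_sum, ← Finset.mul_sum, hps.2.2, hqs.2.2]
      ring
  let H : unitInterval × X → 𝒰.N := fun z => ⟨_, hmem z⟩
  have hH : Continuous H := by
    refine Realization.continuous_of_locallyFinite (fun U => ?_) fun z => ?_
    · have h1 := (Realization.continuous_bary U).comp (p.continuous.comp (continuous_snd (X := unitInterval)))
      have h2 := (Realization.continuous_bary U).comp (q.continuous.comp (continuous_snd (X := unitInterval)))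
      have h3 : Continuous fun z : unitInterval × X => (z.1 : ℝ) := continuous_subtype_val.comp continuous_fst
      exact ((continuous_const.sub h3).mul h1).add (h3.mul h2)
    · obtain ⟨A, hA, hAf⟩ := hpf z.2
      obtain ⟨B, hB, hBf⟩ := hqf z.2
      refine ⟨Prod.snd ⁻¹' (A ∩ B), continuous_snd.continuousAt (Filter.inter_mem hA hB),
        (hAf.union hBf).subset ?_⟩
      rintro U ⟨y, hy, hyA, hyB⟩
      by_contra hn
      have h1 : (p y.2).bary U = 0 := by
        by_contra h
        exact hn (Or.inl ⟨y.2, h, hyA⟩)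
      have h2 : (q y.2).bary U = 0 := by
        by_contra h
        exact hn (Or.inr ⟨y.2, h, hyB⟩)
      exact hy (by simp [H, h1, h2])
  have hH0 : ∀ x, H (0, x) = p x := fun x => by ext; simp [H]
  have hH1 : ∀ x, H (1, x) = q x := fun x => by ext; simp [H]
  have hHb : ∀ t, H (t, x₀) = 𝒰.base := fun t => by
    ext U
    simp only [H, hp.map_base, hq.map_base]
    ring
  ext g
  induction g using Path.Homotopic.Quotient.ind with
  | mk α =>
    rw [FundamentalGroup.mapOfEq_apply, FundamentalGroup.mapOfEq_apply,
      ← Path.Homotopic.Quotient.mk_map, ← Path.Homotopic.Quotient.mk_map,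
      ← Path.Homotopic.Quotient.mk_cast, ← Path.Homotopic.Quotient.mk_cast]
    refine Path.Homotopic.Quotient.eq.2 ⟨{
      toFun := fun z => H (z.1, α z.2)
      continuous_toFun := hH.comp (by fun_prop)
      map_zero_left := fun s => hH0 _
      map_one_left := fun s => hH1 _
      prop' := fun t s hs => ?_ }⟩
    have hs' : α s = x₀ := by
      rcases hs with rfl | rfl
      exacts [α.source, α.target]
    change H (t, α s) = p (α s)
    rw [hs', hHb, hp.map_base]

/-- Canonical maps are compatible with the bonding maps on fundamental groups. -/
theorem hom_comp_canonicalHom (r : Refinement 𝒱 𝒰) :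
    r.hom.comp 𝒱.canonicalHom = 𝒰.canonicalHom := by
  have hc : 𝒰.IsCanonical (r.map.comp 𝒱.canonicalMap) := by
    refine ⟨?_, fun U x hx => ?_⟩
    · rw [ContinuousMap.comp_apply, 𝒱.isCanonical_canonicalMap.map_base, r.map_base]
    · obtain ⟨V, rfl, hV⟩ := Realization.exists_of_simplicialMap_ne_zero
        (hr := r.image_mem) (ne_of_gt hx)
      exact r.subset V (𝒱.isCanonical_canonicalMap.preimage_star V
        (lt_of_le_of_ne (Realization.bary_nonneg _ _) (Ne.symm hV)))
  have hf : LocallyFinite fun U => Function.support fun x =>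
      ((r.map.comp 𝒱.canonicalMap) x).bary U := fun x => by
    obtain ⟨A, hA, hAf⟩ := 𝒱.normal.choose.locallyFinite x
    refine ⟨A, hA, (hAf.image r.toFun).subset ?_⟩
    rintro U ⟨y, hy, hyA⟩
    obtain ⟨V, rfl, hV⟩ := Realization.exists_of_simplicialMap_ne_zero
      (hr := r.image_mem) hy
    exact ⟨V, ⟨y, hV, hyA⟩, rfl⟩
  refine Eq.trans ?_ (mapOfEq_eq_of_isCanonical hc 𝒰.isCanonical_canonicalMap hf
    𝒰.normal.choose.locallyFinite)
  ext g
  simp only [Refinement.hom, canonicalHom, MonoidHom.comp_apply, FundamentalGroup.mapOfEq_apply]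
  induction g using Path.Homotopic.Quotient.ind with
  | mk α => rfl

end PointedNormalCover

/-! ### The first shape homotopy group -/

/-- The first shape homotopy group `π̌₁(X, x₀)`: the inverse limit of the groups `π₁(N(𝒰), ∗)` over
all pointed normal covers, that is, the group of families compatible with all bonding
homomorphisms. (Any two refinement projections `𝒱 → 𝒰` induce the same homomorphism.) -/
def shapeGroup (x₀ : X) :
    Subgroup (∀ 𝒰 : PointedNormalCover x₀, FundamentalGroup 𝒰.N 𝒰.base) where
  carrier := {g | ∀ (𝒱 𝒰 : PointedNormalCover x₀) (r : PointedNormalCover.Refinement 𝒱 𝒰),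
    r.hom (g 𝒱) = g 𝒰}
  mul_mem' ha hb := fun 𝒱 𝒰 r => by
    rw [Pi.mul_apply, Pi.mul_apply, map_mul, ha 𝒱 𝒰 r, hb 𝒱 𝒰 r]
  one_mem' := fun 𝒱 𝒰 r => by rw [Pi.one_apply, Pi.one_apply, map_one]
  inv_mem' ha := fun 𝒱 𝒰 r => by rw [Pi.inv_apply, Pi.inv_apply, map_inv, ha 𝒱 𝒰 r]

/-- The natural homomorphism `φ : π₁(X, x₀) → π̌₁(X, x₀)`, `[α] ↦ ([p_𝒰 ∘ α])_𝒰`. -/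
def naturalHom (x₀ : X) : FundamentalGroup X x₀ →* shapeGroup x₀ :=
  (MonoidHom.pi fun 𝒰 : PointedNormalCover x₀ => 𝒰.canonicalHom).codRestrict (shapeGroup x₀)
    fun g _ _ r => DFunLike.congr_fun (PointedNormalCover.hom_comp_canonicalHom r) g

/-! ### Homotopically Hausdorff spaces -/

/-- `X` is homotopically Hausdorff at `x₀`: every nontrivial element of `π₁(X, x₀)` fails to be
represented by a loop in some open neighbourhood of `x₀`. -/
def HomotopicallyHausdorffAt (x₀ : X) : Prop :=
  ∀ g : FundamentalGroup X x₀, g ≠ 1 → ∃ U : Set X, IsOpen U ∧ x₀ ∈ U ∧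
    ¬ ∃ α : Path x₀ x₀, (∀ t, α t ∈ U) ∧
      FundamentalGroup.fromPath (Path.Homotopic.Quotient.mk α) = g

/-- `X` is homotopically Hausdorff if it is so at every point. -/
def HomotopicallyHausdorff (X : Type u) [TopologicalSpace X] : Prop :=
  ∀ x : X, HomotopicallyHausdorffAt x

/-! ### The surface of revolution of the topologist's sine curve -/

/-- The topologist's sine curve in the half plane `z = 0`, `x ≥ 0` of `ℝ³`. -/
def sineCurve : Set (EuclideanSpace ℝ (Fin 3)) :=
  {p | p 2 = 0 ∧ 0 < p 0 ∧ p 0 ≤ 1 ∧ p 1 = Real.sin (1 / p 0)} ∪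
    {p | p 0 = 0 ∧ p 1 ∈ Icc (-1 : ℝ) 1 ∧ p 2 = 0}

/-- Rotation of `ℝ³` about the `y`-axis by the angle `θ`. -/
def rotateY (θ : ℝ) (p : EuclideanSpace ℝ (Fin 3)) : EuclideanSpace ℝ (Fin 3) :=
  !₂[p 0 * Real.cos θ - p 2 * Real.sin θ, p 1, p 0 * Real.sin θ + p 2 * Real.cos θ]

/-- The subset of `ℝ³` obtained by revolving the topologist's sine curve about the `y`-axis. -/
def sineSurface : Set (EuclideanSpace ℝ (Fin 3)) :=
  {q | ∃ θ : ℝ, ∃ p ∈ sineCurve, rotateY θ p = q}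

/-- The base point `(1, sin 1, 0)` of the surface. -/
def sineBase : sineSurface :=
  ⟨!₂[1, Real.sin 1, 0], 0, !₂[1, Real.sin 1, 0], Or.inl (by simp), by
    ext i; fin_cases i <;> simp [rotateY]⟩

end

namespace Realization

variable {ι : Type*} {K : PreAbstractSimplicialComplex ι}

/-- The open star of a point `c`: the points whose carrier contains the carrier of `c`. -/
def star (c : Realization K) : Set (Realization K) :=
  {b | ∀ i, c.bary i ≠ 0 → b.bary i ≠ 0}

theorem mem_star_self (c : Realization K) : c ∈ star c := fun _ h => h

theorem mem_star_vertex {v : ι} {hv : {v} ∈ K.faces} {b : Realization K} :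
    b ∈ star (vertex K v hv) ↔ b.bary v ≠ 0 := by
  classical
  refine ⟨fun h => h v (by rw [vertex_bary]; simp), fun h i hi => ?_⟩
  rw [vertex_bary] at hi
  by_cases hiv : i = v
  · exact hiv ▸ h
  · simp [hiv] at hi

theorem isOpen_star (c : Realization K) : IsOpen (star c) := by
  have : star c = ⋂ i ∈ c.finite_support.toFinset, {b : Realization K | b.bary i ≠ 0} := by
    ext; simp [star]
  rw [this]
  exact isOpen_biInter_finset fun i _ => isOpen_ne_fun (continuous_bary i) continuous_const

theorem isOpen_iff {O : Set (Realization K)} :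
    IsOpen O ↔ ∀ s : K.faces, IsOpen (ofSimplex K s ⁻¹' O) := by
  simp only [isOpen_iSup_iff, isOpen_coinduced]

theorem combination_mem_geomSimplex {s : Finset ι} {w w' : ι → ℝ} (hw : w ∈ geomSimplex s)
    (hw' : w' ∈ geomSimplex s) (t : unitInterval) :
    (fun i => (1 - (t : ℝ)) * w i + t * w' i) ∈ geomSimplex s := by
  refine ⟨fun i => ?_, fun i hi => ?_, ?_⟩
  · exact add_nonneg (mul_nonneg (sub_nonneg.2 t.2.2) (hw.1 i)) (mul_nonneg t.2.1 (hw'.1 i))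
  · simp [hw.2.1 i hi, hw'.2.1 i hi]
  · rw [Finset.sum_add_distrib, ← Finset.mul_sum, ← Finset.mul_sum, hw.2.2, hw'.2.2]
    ring

theorem mem_geomSimplex_of_mem_star {b c : Realization K} (h : b ∈ star c) {s : Finset ι}
    (hb : b.bary ∈ geomSimplex s) : c.bary ∈ geomSimplex s :=
  c.mem_geomSimplex fun i hi => by
    by_contra hc
    exact h i hc (hb.2.1 i hi)

/-- The point `(1 - t) b + t c` of the carrier of `b`, for `b` in the open star of `c`. -/
def push {b c : Realization K} (h : b ∈ star c) (t : unitInterval) : Realization K :=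
  ⟨fun i => (1 - (t : ℝ)) * b.bary i + t * c.bary i, by
    obtain ⟨s, hs, hb⟩ := b.mem
    exact ⟨s, hs, combination_mem_geomSimplex hb (mem_geomSimplex_of_mem_star h hb) t⟩⟩

theorem push_mem_star {b c : Realization K} (h : b ∈ star c) (t : unitInterval) :
    push h t ∈ star c := fun i hi => by
  have hb := lt_of_le_of_ne (b.bary_nonneg i) (h i hi).symm
  have hc := lt_of_le_of_ne (c.bary_nonneg i) (Ne.symm hi)
  refine ne_of_gt (show 0 < (1 - (t : ℝ)) * b.bary i + t * c.bary i from ?_)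
  rcases t.2.1.eq_or_lt with h | h
  · rw [← h]; simpa using hb
  · exact add_pos_of_nonneg_of_pos (mul_nonneg (sub_nonneg.2 t.2.2) hb.le) (mul_pos h hc)

theorem push_zero {b c : Realization K} (h : b ∈ star c) : push h 0 = b := by
  ext; simp [push]

theorem push_one {b c : Realization K} (h : b ∈ star c) : push h 1 = c := by
  ext; simp [push]

/-- The affine contraction of a closed simplex onto one of its points. -/
theorem continuous_push_ofSimplex (c : Realization K) (s : K.faces) (hc : c.bary ∈ geomSimplex s.1) :
    Continuous fun z : geomSimplex s.1 × unitInterval =>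
      ofSimplex K s ⟨_, combination_mem_geomSimplex z.1.2 hc z.2⟩ := by
  refine (continuous_ofSimplex s).comp (Continuous.subtype_mk (continuous_pi fun i => ?_) _)
  have h1 : Continuous fun z : geomSimplex s.1 × unitInterval => z.1.1 i :=
    (continuous_apply i).comp (continuous_subtype_val.comp continuous_fst)
  fun_prop

theorem continuous_push (c : Realization K) :
    Continuous fun z : star c × unitInterval => push z.1.2 z.2 := by
  classical
  let path : star c → C(unitInterval, Realization K) := fun b =>
    ⟨push b.2, by
      obtain ⟨s, hs, hb⟩ := b.1.mem
      exact (continuous_push_ofSimplex c ⟨s, hs⟩ (mem_geomSimplex_of_mem_star b.2 hb)).comp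
        (Continuous.prodMk_right (⟨b.1.bary, hb⟩ : geomSimplex s))⟩
  suffices h : Continuous path by
    exact (ContinuousEval.continuous_eval (F := C(unitInterval, Realization K))).comp
      (h.prodMap continuous_id)
  refine continuous_def.2 fun O hO => ?_
  rw [(isOpen_star c).isOpenEmbedding_subtypeVal.isOpen_iff_image_isOpen, isOpen_iff]
  intro s
  by_cases hs : c.bary ∈ geomSimplex s.1
  · let g : C(geomSimplex s.1, C(unitInterval, Realization K)) :=
      ContinuousMap.curry ⟨_, continuous_push_ofSimplex c s hs⟩
    have : ofSimplex K s ⁻¹' (Subtype.val '' (path ⁻¹' O)) =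
        ofSimplex K s ⁻¹' star c ∩ g ⁻¹' O := by
      ext w
      constructor
      · rintro ⟨b, hb, hbw⟩
        refine ⟨by rw [mem_preimage, ← hbw]; exact b.2, ?_⟩
        have : g w = path b := by
          ext t i
          simp only [path, ContinuousMap.coe_mk, push, hbw]
          rfl
        rwa [mem_preimage, this]
      · rintro ⟨hw, hO⟩
        exact ⟨⟨_, hw⟩, hO, rfl⟩
    rw [this]
    exact ((isOpen_star c).preimage (continuous_ofSimplex s)).inter (hO.preimage g.continuous)
  · convert isOpen_empty
    refine eq_empty_of_forall_notMem ?_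
    rintro w ⟨b, -, hb⟩
    exact hs (mem_geomSimplex_of_mem_star b.2 (hb ▸ w.2))

instance contractibleSpace_star (c : Realization K) : ContractibleSpace (star c) := by
  rw [contractible_iff_id_nullhomotopic]
  refine ⟨⟨c, mem_star_self c⟩, ⟨{
    toFun := fun z => ⟨push z.2.2 z.1, push_mem_star z.2.2 z.1⟩
    continuous_toFun := ((continuous_push c).comp continuous_swap).subtype_mk _
    map_zero_left := fun b => Subtype.ext (push_zero b.2)
    map_one_left := fun b => Subtype.ext (push_one b.2) }⟩⟩

/-- The midpoint of two points whose stars meet; its star is the intersection of the stars. -/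
theorem exists_star_eq_inter {c c' a : Realization K} (h : a ∈ star c) (h' : a ∈ star c') :
    ∃ m : Realization K, star m = star c ∩ star c' := by
  obtain ⟨s, hs, ha⟩ := a.mem
  refine ⟨⟨_, s, hs, combination_mem_geomSimplex (mem_geomSimplex_of_mem_star h ha)
    (mem_geomSimplex_of_mem_star h' ha) ⟨1 / 2, by norm_num, by norm_num⟩⟩, ?_⟩
  have key : ∀ i, (1 - (1 / 2 : ℝ)) * c.bary i + 1 / 2 * c'.bary i ≠ 0 ↔
      c.bary i ≠ 0 ∨ c'.bary i ≠ 0 := fun i => by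
    have h1 := c.bary_nonneg i
    have h2 := c'.bary_nonneg i
    rw [← not_and_or, not_iff_not]
    exact ⟨fun h => ⟨by linarith, by linarith⟩, fun h => by rw [h.1, h.2]; ring⟩
  ext b
  simp only [star, mem_ofPred_eq, mem_inter_iff, key, or_imp, forall_and]

/-- Two paths in an open star with the same end points are homotopic. -/
theorem mk_eq_mk_of_mem_star {c a b : Realization K} {γ γ' : Path a b} (h : ∀ t, γ t ∈ star c)
    (h' : ∀ t, γ' t ∈ star c) :
    Path.Homotopic.Quotient.mk γ = Path.Homotopic.Quotient.mk γ' := by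
  have ha : a ∈ star c := by simpa using h 0
  have hb : b ∈ star c := by simpa using h 1
  let lift (γ : Path a b) (h : ∀ t, γ t ∈ star c) : Path (⟨a, ha⟩ : star c) ⟨b, hb⟩ :=
    { toFun := fun t => ⟨γ t, h t⟩
      continuous_toFun := by fun_prop
      source' := Subtype.ext γ.source
      target' := Subtype.ext γ.target }
  exact Path.Homotopic.Quotient.eq.2 ((SimplyConnectedSpace.paths_homotopic
    (lift γ h) (lift γ' h')).map ⟨Subtype.val, continuous_subtype_val⟩)

theorem exists_path_in_star {c a b : Realization K} (ha : a ∈ star c) (hb : b ∈ star c) :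
    ∃ γ : Path a b, ∀ t, γ t ∈ star c :=
  ⟨(PathConnectedSpace.somePath (⟨a, ha⟩ : star c) ⟨b, hb⟩).map continuous_subtype_val,
    fun t => (PathConnectedSpace.somePath (⟨a, ha⟩ : star c) ⟨b, hb⟩ t).2⟩

/-- The homotopy class of the paths from `a` to `b` that stay in the open star of `c`. -/
noncomputable def short {c a b : Realization K} (ha : a ∈ star c) (hb : b ∈ star c) :
    Path.Homotopic.Quotient a b :=
  .mk (exists_path_in_star ha hb).choose

theorem mk_eq_short {c a b : Realization K} {γ : Path a b} (h : ∀ t, γ t ∈ star c)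
    (ha : a ∈ star c) (hb : b ∈ star c) : .mk γ = short ha hb :=
  mk_eq_mk_of_mem_star h (exists_path_in_star ha hb).choose_spec

theorem short_eq_short {c c' a b : Realization K} (ha : a ∈ star c) (hb : b ∈ star c)
    (ha' : a ∈ star c') (hb' : b ∈ star c') : short ha hb = short ha' hb' := by
  obtain ⟨m, hm⟩ := exists_star_eq_inter ha ha'
  obtain ⟨γ, hγ⟩ := exists_path_in_star (c := m) (a := a) (b := b)
    (by rw [hm]; exact ⟨ha, ha'⟩) (by rw [hm]; exact ⟨hb, hb'⟩)
  rw [hm] at hγ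
  rw [← mk_eq_short (fun t => (hγ t).1) ha hb, ← mk_eq_short (fun t => (hγ t).2) ha' hb']

theorem short_trans {c a b d : Realization K} (ha : a ∈ star c) (hb : b ∈ star c)
    (hd : d ∈ star c) : (short ha hb).trans (short hb hd) = short ha hd := by
  rw [short, short, ← Path.Homotopic.Quotient.mk_trans]
  refine mk_eq_short (fun t => ?_) ha hd
  rw [Path.trans_apply]
  split_ifs
  exacts [(exists_path_in_star ha hb).choose_spec _, (exists_path_in_star hb hd).choose_spec _]

theorem short_self {c a : Realization K} (ha : a ∈ star c) : short ha ha = .refl a :=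
  (mk_eq_short (γ := Path.refl a) (fun _ => ha) ha ha).symm

end Realization

namespace Realization

open Path.Homotopic (Quotient)

variable {ι : Type*} {K : PreAbstractSimplicialComplex ι} {Y : Type*} [TopologicalSpace Y]
  {a : Realization K}

/-- A family of homotopy classes of paths from `a` to the points `f z` is flat at `y` if for `z`
near `y` it changes by short paths only. -/
def FlatAt (f : Y → Realization K) (H : ∀ y, Quotient a (f y)) (y : Y) : Prop :=
  ∀ᶠ z in 𝓝 y, ∃ hz : f z ∈ star (f y), H z = (H y).trans (short (mem_star_self _) hz)

/-- `f` admits a family of classes of paths to its values that is flat everywhere. For a suitable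
base point, this says that `f` lifts to the universal cover. -/
def HasFlatFamily (f : Y → Realization K) : Prop :=
  ∃ (a : Realization K) (H : ∀ y, Quotient a (f y)), ∀ y, FlatAt f H y

theorem trans_short_trans {c b d e : Realization K} (hb : b ∈ star c) (hd : d ∈ star c)
    (he : e ∈ star c) (g : Quotient a b) :
    (g.trans (short hb hd)).trans (short hd he) = g.trans (short hb he) := by
  rw [Quotient.trans_assoc, short_trans]

theorem trans_short_right_inj {c b d : Realization K} (hb : b ∈ star c) (hd : d ∈ star c)
    {g g' : Quotient a b} (h : g.trans (short hb hd) = g'.trans (short hb hd)) : g = g' := by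
  have := congrArg (fun k => k.trans (short hd hb)) h
  simpa only [trans_short_trans, short_self, Quotient.trans_refl] using this

theorem flatAt_iff {f : Y → Realization K} {H : ∀ y, Quotient a (f y)} {y : Y}
    (hf : ContinuousAt f y) {c : Realization K} (hc : f y ∈ star c) :
    FlatAt f H y ↔ ∀ᶠ z in 𝓝 y, ∃ hz : f z ∈ star c, H z = (H y).trans (short hc hz) := by
  have h1 := hf.eventually_mem ((isOpen_star (f y)).mem_nhds (mem_star_self _))
  have h2 := hf.eventually_mem ((isOpen_star c).mem_nhds hc)
  constructor
  · intro h
    filter_upwards [h, h2] with z ⟨hz, h⟩ hz'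
    exact ⟨hz', h.trans (by rw [short_eq_short])⟩
  · intro h
    filter_upwards [h, h1] with z ⟨hz, h⟩ hz'
    exact ⟨hz', h.trans (by rw [short_eq_short])⟩

theorem hasFlatFamily_const (c : Realization K) : HasFlatFamily fun _ : Y => c :=
  ⟨c, fun _ => .refl c, fun _ => .of_forall fun _ =>
    ⟨mem_star_self c, by rw [short_self, Quotient.trans_refl]⟩⟩

theorem HasFlatFamily.comp {Z : Type*} [TopologicalSpace Z] {f : Y → Realization K}
    (h : HasFlatFamily f) {g : Z → Y} (hg : Continuous g) : HasFlatFamily (f ∘ g) := by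
  obtain ⟨a, H, hH⟩ := h
  exact ⟨a, fun z => H (g z), fun z => hg.continuousAt.eventually (hH (g z))⟩

/-- Flat families pass on to contiguous maps. -/
theorem HasFlatFamily.of_contiguous {f g : Y → Realization K} (h : HasFlatFamily f)
    (hf : Continuous f) (hg : Continuous g) (hfg : ∀ y, ∃ c, f y ∈ star c ∧ g y ∈ star c) :
    HasFlatFamily g := by
  obtain ⟨a, H, hH⟩ := h
  choose c hc hc' using hfg
  refine ⟨a, fun y => (H y).trans (short (hc y) (hc' y)), fun y => ?_⟩
  rw [flatAt_iff hg.continuousAt (hc' y)]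
  filter_upwards [(flatAt_iff hf.continuousAt (hc y)).1 (hH y),
    hg.continuousAt.eventually_mem ((isOpen_star (c y)).mem_nhds (hc' y))] with z ⟨hz, h⟩ hz'
  refine ⟨hz', ?_⟩
  rw [h, short_eq_short (hc z) (hc' z) hz hz', trans_short_trans, trans_short_trans]

/-- The restriction of a continuous map on the unit interval to the segment from `t` to `t'`. -/
def arc {X : Type*} [TopologicalSpace X] {g : unitInterval → X} (hg : Continuous g)
    (t t' : unitInterval) : Path (g t) (g t') where
  toFun s := g (Icc.convexComb t t' s)
  continuous_toFun := hg.comp (Icc.continuous_convexComb_prod.comp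
    (by fun_prop : Continuous fun s : unitInterval => (t, t', s)))
  source' := by simp
  target' := by simp

theorem mk_arc_trans {X : Type*} [TopologicalSpace X] {g : unitInterval → X} (hg : Continuous g)
    (t₀ t₁ t₂ : unitInterval) :
    (Path.Homotopic.Quotient.mk (arc hg t₀ t₁)).trans (Path.Homotopic.Quotient.mk (arc hg t₁ t₂)) =
      Path.Homotopic.Quotient.mk (arc hg t₀ t₂) :=
  Path.Homotopic.Quotient.eq.2 ⟨Path.Homotopy.subpathTransSubpath
    (⟨⟨g, hg⟩, rfl, rfl⟩ : Path (g 0) (g 1)) t₀ t₁ t₂⟩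

theorem mk_arc_self {X : Type*} [TopologicalSpace X] {g : unitInterval → X} (hg : Continuous g)
    (t : unitInterval) : Path.Homotopic.Quotient.mk (arc hg t t) = .refl (g t) := by
  have : arc hg t t = Path.refl (g t) := by
    ext s
    simp [arc]
  rw [this]
  rfl

/-- Along a path, a flat family changes by the class of the image of the path. -/
theorem trans_mk_arc_of_flatAt {f : Y → Realization K} (hf : Continuous f)
    {H : ∀ y, Quotient a (f y)} (hH : ∀ y, FlatAt f H y) {β : unitInterval → Y}
    (hβ : Continuous β) (t t' : unitInterval) :
    (H (β t)).trans (.mk (arc (hf.comp hβ) t t')) = H (β t') := by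
  have hg : Continuous fun t => f (β t) := hf.comp hβ
  let P : unitInterval → unitInterval → Prop := fun t t' =>
    (H (β t)).trans (.mk (arc hg t t')) = H (β t')
  have htrans : IsTrans _ P := ⟨fun t₀ t₁ t₂ h h' => by
    simp only [P] at h h' ⊢
    rw [← h', ← h, Quotient.trans_assoc, mk_arc_trans]⟩
  have hsymm : Std.Symm P := ⟨fun t₀ t₁ h => by
    simp only [P] at h ⊢
    rw [← h, Quotient.trans_assoc, mk_arc_trans, mk_arc_self, Quotient.trans_refl]⟩
  have hloc : ∀ t₀, ∀ᶠ t in 𝓝 t₀, P t₀ t := fun t₀ => by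
    have h1 : ∀ᶠ t in 𝓝 t₀, ∀ s ∈ (univ : Set unitInterval),
        f (β (Icc.convexComb t₀ t s)) ∈ star (f (β t₀)) := by
      refine isCompact_univ.eventually_forall_of_forall_eventually fun s _ => ?_
      have hc : Continuous fun z : unitInterval × unitInterval =>
          f (β (Icc.convexComb t₀ z.1 z.2)) :=
        hg.comp (Icc.continuous_convexComb_prod.comp
          (by fun_prop : Continuous fun z : unitInterval × unitInterval => (t₀, z.1, z.2)))
      refine hc.continuousAt.eventually_mem ((isOpen_star _).mem_nhds ?_)
      simpa using mem_star_self _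
    filter_upwards [h1, hβ.continuousAt.eventually (hH (β t₀))] with t ht ⟨hz, h⟩
    simp only [P]
    rw [h, mk_eq_short (γ := arc hg t₀ t) (fun s => ht s trivial) (mem_star_self _) hz]
  exact PreconnectedSpace.induction₂ P hloc htrans t t'

/-- A map with a flat family is trivial on fundamental groups. -/
theorem HasFlatFamily.mapOfEq_eq_one {f : C(Y, Realization K)} (h : HasFlatFamily f) {y : Y}
    {b : Realization K} (hb : f y = b) (g : FundamentalGroup Y y) :
    FundamentalGroup.mapOfEq f hb g = 1 := by
  obtain ⟨a, H, hH⟩ := h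
  subst hb
  induction g using Path.Homotopic.Quotient.ind with
  | mk β =>
    rw [FundamentalGroup.mapOfEq_apply, Quotient.cast_rfl_rfl, ← Quotient.mk_map]
    have key : ∀ (y y' : Y) (β : Path y y'),
        (H y).trans (Path.Homotopic.Quotient.mk (β.map f.continuous)) = H y' := by
      rintro _ _ ⟨β, rfl, rfl⟩
      refine Eq.trans (congrArg _ (congrArg Path.Homotopic.Quotient.mk (Path.ext
        (funext fun s => ?_)))) (trans_mk_arc_of_flatAt f.continuous hH β.continuous 0 1)
      simp [arc]
    have h := congrArg (fun k => (H y).symm.trans k) (key y y β)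
    simp only [← Quotient.trans_assoc, Quotient.symm_trans, Quotient.refl_trans] at h
    exact h

/-- Flat families pass on to homotopic maps. -/
theorem HasFlatFamily.of_homotopy {F : unitInterval × Y → Realization K} (hF : Continuous F)
    (h : HasFlatFamily fun y => F (0, y)) : HasFlatFamily fun y => F (1, y) := by
  obtain ⟨a, H, hH⟩ := h
  have hγ : ∀ y, Continuous fun t => F (t, y) := fun y => by fun_prop
  let G : ∀ t y, Quotient a (F (t, y)) := fun t y => (H y).trans (.mk (arc (hγ y) 0 t))
  suffices h : ∀ y t, FlatAt (fun y => F (t, y)) (G t) y from ⟨a, G 1, fun y => h y 1⟩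
  intro y t
  let P : unitInterval → unitInterval → Prop := fun t t' =>
    FlatAt (fun y => F (t, y)) (G t) y ↔ FlatAt (fun y => F (t', y)) (G t') y
  have htrans : IsTrans _ P := ⟨fun _ _ _ h h' => h.trans h'⟩
  have hsymm : Std.Symm P := ⟨fun _ _ h => h.symm⟩
  have hloc : ∀ t₀, ∀ᶠ t in 𝓝 t₀, P t₀ t := fun t₀ => by
    have h1 : ∀ᶠ z : unitInterval × Y in 𝓝 (t₀, y), ∀ s ∈ (univ : Set unitInterval),
        F (Icc.convexComb t₀ z.1 s, z.2) ∈ star (F (t₀, y)) := by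
      refine isCompact_univ.eventually_forall_of_forall_eventually fun s _ => ?_
      have hc : Continuous fun z : (unitInterval × Y) × unitInterval =>
          F (Icc.convexComb t₀ z.1.1 z.2, z.1.2) :=
        hF.comp ((Icc.continuous_convexComb_prod.comp (by fun_prop :
          Continuous fun z : (unitInterval × Y) × unitInterval => (t₀, z.1.1, z.2))).prodMk
          (by fun_prop))
      refine hc.continuousAt.eventually_mem ((isOpen_star _).mem_nhds ?_)
      simpa using mem_star_self _
    filter_upwards [h1.curry_nhds] with t ht
    have hy := ht.self_of_nhds
    have mem0 : ∀ {z}, (∀ s ∈ (univ : Set unitInterval),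
        F (Icc.convexComb t₀ t s, z) ∈ star (F (t₀, y))) → F (t₀, z) ∈ star (F (t₀, y)) :=
      fun h => by simpa using h 0 trivial
    have mem1 : ∀ {z}, (∀ s ∈ (univ : Set unitInterval),
        F (Icc.convexComb t₀ t s, z) ∈ star (F (t₀, y))) → F (t, z) ∈ star (F (t₀, y)) :=
      fun h => by simpa using h 1 trivial
    have hG : ∀ {z} (h : ∀ s ∈ (univ : Set unitInterval),
        F (Icc.convexComb t₀ t s, z) ∈ star (F (t₀, y))),
        G t z = (G t₀ z).trans (short (mem0 h) (mem1 h)) := fun {z} h => by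
      simp only [G]
      rw [← mk_arc_trans (hγ z) 0 t₀ t, ← Quotient.trans_assoc,
        mk_eq_short (γ := arc (hγ z) t₀ t) (fun s => h s trivial) (mem0 h) (mem1 h)]
    simp only [P]
    rw [flatAt_iff (f := fun y => F (t₀, y)) (by fun_prop) (mem0 hy),
      flatAt_iff (f := fun y => F (t, y)) (by fun_prop) (mem1 hy)]
    constructor
    · intro hflat
      filter_upwards [hflat, ht] with z ⟨hz, h⟩ hz'
      exact ⟨mem1 hz', by rw [hG hz', hG hy, h, trans_short_trans, trans_short_trans]⟩
    · intro hflat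
      filter_upwards [hflat, ht] with z ⟨hz, h⟩ hz'
      refine ⟨mem0 hz', trans_short_right_inj (mem0 hz') (mem1 hz') ?_⟩
      rw [← hG hz', h, hG hy, trans_short_trans, trans_short_trans]
  refine (PreconnectedSpace.induction₂ P hloc htrans 0 t).1 ?_
  have h0 : G 0 = H := funext fun z => by
    simp only [G]
    rw [mk_arc_self, Quotient.trans_refl]
  rw [h0]
  exact hH y

end Realization

namespace Realization

theorem simplicialMap_bary_ne_zero {ι κ : Type*} {K : PreAbstractSimplicialComplex ι}
    {L : PreAbstractSimplicialComplex κ} {r : ι → κ}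
    (hr : ∀ s ∈ K.faces, ∀ t : Finset κ, (t : Set κ) = r '' s → t ∈ L.faces) {b : Realization K}
    {v : ι} (hv : b.bary v ≠ 0) : (simplicialMap r hr b).bary (r v) ≠ 0 := by
  classical
  obtain ⟨s, hs, hb⟩ := b.mem
  change (∑ᶠ i, if r i = r v then b.bary i else 0) ≠ 0
  rw [push_eq_sum r hb.2.1]
  have hvs : v ∈ s := by
    by_contra h
    exact hv (hb.2.1 v h)
  have h1 := Finset.single_le_sum (f := fun i => if r i = r v then b.bary i else 0)
    (fun i _ => by split_ifs; exacts [b.bary_nonneg i, le_rfl]) hvs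
  have h2 := lt_of_le_of_ne (b.bary_nonneg v) hv.symm
  simp only [if_true] at h1
  exact (h2.trans_le h1).ne'

end Realization

namespace PointedNormalCover

open Path.Homotopic (Quotient)
open Realization

variable {X : Type u} [TopologicalSpace X] {x₀ : X}

theorem canonicalHom_eq_one_of_mem_star (𝒰 : PointedNormalCover x₀) (α : Path x₀ x₀)
    (h : ∀ t, 𝒰.canonicalMap (α t) ∈ star 𝒰.base) :
    𝒰.canonicalHom (FundamentalGroup.fromPath (.mk α)) = 1 := by
  rw [canonicalHom, FundamentalGroup.mapOfEq_apply, FundamentalGroup.one_def,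
    ← Quotient.mk_map, ← Quotient.mk_cast]
  exact mk_eq_mk_of_mem_star (γ' := Path.refl _) h fun _ => mem_star_self _

/-- A loop that the canonical map carries into the star of the base vertex is trivial in the
nerve, so the shape group detects only loops that leave some neighbourhood of the base point. -/
theorem homotopicallyHausdorffAt_of_injective (h : Function.Injective (naturalHom x₀)) :
    HomotopicallyHausdorffAt x₀ := by
  intro g hg
  obtain ⟨𝒰, h𝒰⟩ : ∃ 𝒰 : PointedNormalCover x₀, 𝒰.canonicalHom g ≠ 1 := by
    by_contra! hn
    exact hg (h (Subtype.ext (funext fun 𝒰 => (hn 𝒰).trans (map_one 𝒰.canonicalHom).symm)))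
  refine ⟨𝒰.canonicalMap ⁻¹' star 𝒰.base,
    (isOpen_star _).preimage 𝒰.canonicalMap.continuous, ?_, ?_⟩
  · rw [mem_preimage, 𝒰.isCanonical_canonicalMap.map_base]
    exact mem_star_self _
  · rintro ⟨α, hα, rfl⟩
    exact h𝒰 (𝒰.canonicalHom_eq_one_of_mem_star α hα)

/-- A pointed open cover of a paracompact normal space in which only the designated member contains
the base point is normal. -/
theorem exists_partitionOfUnity_of_mem_imp_eq [NormalSpace X] [ParacompactSpace X]
    {S : Set (Set X)} (hS : ∀ U ∈ S, IsOpen U) (hcov : ⋃₀ S = univ) (V : S)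
    (hV : ∀ W : S, x₀ ∈ (W : Set X) → W = V) :
    ∃ f : PartitionOfUnity S X, f.IsSubordinate (fun U => (U : Set X)) ∧ f V x₀ = 1 := by
  obtain ⟨f, hf⟩ := PartitionOfUnity.exists_isSubordinate isClosed_univ (fun U : S => (U : Set X))
    (fun U => hS U U.2) (by rw [← sUnion_eq_iUnion, hcov])
  refine ⟨f, hf, ?_⟩
  have h0 : ∀ W, W ≠ V → f W x₀ = 0 := fun W hW => by
    by_contra hn
    exact hW (hV W (hf W (subset_tsupport _ hn)))
  rw [← f.sum_eq_one (mem_univ x₀), finsum_eq_single _ V h0]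

/-- `V` is small for a flat family `H` along the canonical map if `V` lies over the star of the
vertex `U` and `H` changes by short paths inside `V`. -/
def SmallFor (𝒰 : PointedNormalCover x₀) {a : 𝒰.N} (H : ∀ x, Quotient a (𝒰.canonicalMap x))
    (V : Set X) (U : 𝒰.sets) : Prop :=
  ∃ c : 𝒰.N, (∀ b : 𝒰.N, b ∈ star c ↔ b.bary U ≠ 0) ∧
    ∀ x ∈ V, ∀ y ∈ V, ∃ (hx : 𝒰.canonicalMap x ∈ star c) (hy : 𝒰.canonicalMap y ∈ star c),
      H y = (H x).trans (short hx hy)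

theorem SmallFor.subset {𝒰 : PointedNormalCover x₀} {a : 𝒰.N}
    {H : ∀ x, Quotient a (𝒰.canonicalMap x)} {V : Set X} {U : 𝒰.sets} (h : 𝒰.SmallFor H V U) :
    V ⊆ U := by
  obtain ⟨c, hc, h⟩ := h
  intro x hx
  refine 𝒰.isCanonical_canonicalMap.preimage_star U ?_
  exact lt_of_le_of_ne (bary_nonneg _ _) (Ne.symm ((hc _).1 (h x hx x hx).1))

theorem SmallFor.mono {𝒰 : PointedNormalCover x₀} {a : 𝒰.N}
    {H : ∀ x, Quotient a (𝒰.canonicalMap x)} {V W : Set X} {U : 𝒰.sets} (h : 𝒰.SmallFor H V U)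
    (hW : W ⊆ V) : 𝒰.SmallFor H W U := by
  obtain ⟨c, hc, h⟩ := h
  exact ⟨c, hc, fun x hx y hy => h x (hW hx) y (hW hy)⟩

theorem exists_smallFor {𝒰 : PointedNormalCover x₀} {a : 𝒰.N}
    {H : ∀ x, Quotient a (𝒰.canonicalMap x)} (hH : ∀ x, FlatAt 𝒰.canonicalMap H x) (x : X)
    (U : 𝒰.sets) (hU : (𝒰.canonicalMap x).bary U ≠ 0) :
    ∃ V, IsOpen V ∧ x ∈ V ∧ 𝒰.SmallFor H V U := by
  have hface : {U} ∈ (nerve 𝒰.sets).faces := by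
    refine ((nerve 𝒰.sets).isRelLowerSet_faces (𝒰.canonicalMap x).support_mem_faces).2 ?_
      (Finset.singleton_nonempty U)
    simpa using hU
  have hc : 𝒰.canonicalMap x ∈ star (vertex _ U hface) := mem_star_vertex.2 hU
  obtain ⟨V, hV, hVo, hxV⟩ := eventually_nhds_iff.1
    ((flatAt_iff 𝒰.canonicalMap.continuous.continuousAt hc).1 (hH x))
  refine ⟨V, hVo, hxV, vertex _ U hface, fun b => mem_star_vertex, fun y hy z hz => ?_⟩
  obtain ⟨hy', h1⟩ := hV y hy
  obtain ⟨hz', h2⟩ := hV z hz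
  exact ⟨hy', hz', by rw [h1, h2, trans_short_trans]⟩

theorem Refinement.map_bary_ne_zero {𝒰 𝒱 : PointedNormalCover x₀} (r : Refinement 𝒱 𝒰)
    {b : 𝒱.N} {V : 𝒱.sets} (hV : b.bary V ≠ 0) : (r.map b).bary (r.toFun V) ≠ 0 :=
  simplicialMap_bary_ne_zero r.image_mem hV

/-- If the members of `𝒱` are small for a flat family along the canonical map of `𝒰`, then the
family carries over to the bonding map. -/
theorem Refinement.hasFlatFamily_map {𝒰 𝒱 : PointedNormalCover x₀} (r : Refinement 𝒱 𝒰)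
    {a : 𝒰.N} {H : ∀ x, Quotient a (𝒰.canonicalMap x)}
    (h : ∀ V : 𝒱.sets, 𝒰.SmallFor H V (r.toFun V)) : HasFlatFamily r.map := by
  choose c hc hsmall using h
  have hex : ∀ b : 𝒱.N, ∃ V : 𝒱.sets, b.bary V ≠ 0 ∧ ∃ x : X, x ∈ (V : Set X) := fun b => by
    obtain ⟨V, hV⟩ := b.support_mem_faces.1
    obtain ⟨x, hx⟩ := b.support_mem_faces.2
    exact ⟨V, by simpa using hV, x, mem_iInter₂.1 hx V hV⟩
  have hmem : ∀ {b : 𝒱.N} {V : 𝒱.sets}, b.bary V ≠ 0 → r.map b ∈ star (c V) :=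
    fun hV => (hc _ _).2 (r.map_bary_ne_zero hV)
  have hmem' : ∀ {V : 𝒱.sets} {x : X}, x ∈ (V : Set X) → 𝒰.canonicalMap x ∈ star (c V) :=
    fun hx => (hsmall _ _ hx _ hx).1
  choose V hV x hx using hex
  let G : ∀ b, Quotient a (r.map b) := fun b =>
    (H (x b)).trans (short (hmem' (hx b)) (hmem (hV b)))
  have key : ∀ {b : 𝒱.N} {W : 𝒱.sets} (hW : b.bary W ≠ 0) {y : X} (hy : y ∈ (W : Set X)),
      G b = (H y).trans (short (hmem' hy) (hmem hW)) := by
    intro b W hW y hy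
    obtain ⟨z, hz⟩ := b.support_mem_faces.2
    rw [mem_iInter₂] at hz
    have hzV := hz (V b) (by simpa using hV b)
    have hzW := hz W (by simpa using hW)
    obtain ⟨_, _, h1⟩ := hsmall _ _ hzV _ (hx b)
    obtain ⟨_, _, h2⟩ := hsmall _ _ hzW _ hy
    simp only [G]
    rw [h1, h2, trans_short_trans, trans_short_trans,
      short_eq_short (hmem' hzV) (hmem (hV b)) (hmem' hzW) (hmem hW)]
  refine ⟨a, G, fun b => ?_⟩
  rw [flatAt_iff r.map.continuous.continuousAt (hmem (hV b))]
  filter_upwards [(continuous_bary (V b)).continuousAt.eventually_ne (hV b)] with b' hb'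
  refine ⟨hmem hb', ?_⟩
  rw [key hb' (hx b), key (hV b) (hx b), trans_short_trans]

/-- If the canonical map of `𝒰` has a flat family, then the elements of the shape group vanish
at `𝒰`. -/
theorem eq_one_of_hasFlatFamily [T1Space X] [NormalSpace X] [ParacompactSpace X]
    (𝒰 : PointedNormalCover x₀) (h : HasFlatFamily 𝒰.canonicalMap) (g : shapeGroup x₀) :
    g.1 𝒰 = 1 := by
  classical
  obtain ⟨a, H, hH⟩ := h
  have hpt : (𝒰.canonicalMap x₀).bary 𝒰.pt ≠ 0 := by
    rw [𝒰.isCanonical_canonicalMap.map_base, base, vertex_bary]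
    simp
  obtain ⟨V₀, hV₀, hxV₀, hs₀⟩ := exists_smallFor hH x₀ 𝒰.pt hpt
  let S : Set (Set X) := {V | IsOpen V ∧ (∃ U, 𝒰.SmallFor H V U) ∧ (x₀ ∈ V → V = V₀)}
  have hSpt : V₀ ∈ S := ⟨hV₀, ⟨_, hs₀⟩, fun _ => rfl⟩
  have hcov : ⋃₀ S = univ := by
    refine eq_univ_of_forall fun x => ?_
    by_cases hx : x = x₀
    · exact ⟨V₀, hSpt, hx ▸ hxV₀⟩
    · obtain ⟨U, hU⟩ := (𝒰.canonicalMap x).support_mem_faces.1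
      obtain ⟨V, hV, hxV, hs⟩ := exists_smallFor hH x U (by simpa using hU)
      exact ⟨V \ {x₀}, ⟨hV.sdiff isClosed_singleton, ⟨U, hs.mono sdiff_subset⟩,
        fun h => (h.2 rfl).elim⟩, hxV, hx⟩
  let 𝒱 : PointedNormalCover x₀ :=
    { sets := S
      isOpen := fun V hV => hV.1
      sUnion_eq := hcov
      pt := ⟨V₀, hSpt⟩
      mem_pt := hxV₀
      normal := exists_partitionOfUnity_of_mem_imp_eq (fun V hV => hV.1) hcov ⟨V₀, hSpt⟩
        fun W hW => Subtype.ext (W.2.2.2 hW) }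
  have hex : ∀ V : 𝒱.sets, ∃ U, 𝒰.SmallFor H V U ∧ (V = 𝒱.pt → U = 𝒰.pt) := fun V => by
    by_cases hV : V = 𝒱.pt
    · exact ⟨𝒰.pt, hV ▸ hs₀, fun _ => rfl⟩
    · obtain ⟨U, hU⟩ := V.2.2.1
      exact ⟨U, hU, fun h => (hV h).elim⟩
  choose ρ hρ hρpt using hex
  let r : Refinement 𝒱 𝒰 := ⟨ρ, fun V => (hρ V).subset, hρpt _ rfl⟩
  rw [← g.2 𝒱 𝒰 r]
  exact (r.hasFlatFamily_map hρ).mapOfEq_eq_one r.map_base _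

end PointedNormalCover

noncomputable section

namespace SineSurface

open Realization

/-! ### Cylindrical coordinates on the surface -/

/-- The point of `ℝ³` with horizontal coordinates `Re z`, `Im z` and height `y`. -/
def point (z : ℂ) (y : ℝ) : EuclideanSpace ℝ (Fin 3) := !₂[z.re, y, z.im]

theorem continuous_point {T : Type*} [TopologicalSpace T] {z : T → ℂ} {y : T → ℝ}
    (hz : Continuous z) (hy : Continuous y) : Continuous fun t => point (z t) (y t) := by
  unfold point
  fun_prop

theorem rotateY_point (θ r y : ℝ) :
    rotateY θ (point r y) = point (r * Complex.exp (θ * Complex.I)) y := by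
  ext i
  fin_cases i <;> simp [rotateY, point, Complex.exp_ofReal_mul_I_re, Complex.exp_ofReal_mul_I_im]

theorem point_mem_of_pos {z : ℂ} (h0 : 0 < ‖z‖) (h1 : ‖z‖ ≤ 1) :
    point z (Real.sin (1 / ‖z‖)) ∈ sineSurface := by
  refine ⟨z.arg, point ‖z‖ (Real.sin (1 / ‖z‖)), Or.inl ?_, ?_⟩
  · exact ⟨by simp [point], by simpa [point] using h0, by simpa [point] using h1, by simp [point]⟩
  · rw [rotateY_point, Complex.norm_mul_exp_arg_mul_I]

theorem point_zero_mem {y : ℝ} (hy : y ∈ Icc (-1 : ℝ) 1) : point 0 y ∈ sineSurface :=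
  ⟨0, point (0 : ℝ) y, Or.inr ⟨by simp [point], by simpa [point] using hy, by simp [point]⟩, by
    rw [rotateY_point]; simp⟩

/-- The horizontal part of a point of the surface, as a complex number. -/
def hor (x : sineSurface) : ℂ := (x.1 0 : ℂ) + (x.1 2 : ℂ) * Complex.I

/-- The height of a point of the surface. -/
def height (x : sineSurface) : ℝ := x.1 1

theorem continuous_hor : Continuous hor := by
  unfold hor
  fun_prop

theorem continuous_height : Continuous height := by
  unfold height
  fun_prop

theorem point_hor_height (x : sineSurface) : point (hor x) (height x) = x.1 := by
  ext i
  fin_cases i <;> simp [point, hor, height]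

theorem hor_mk {z : ℂ} {y : ℝ} (h : point z y ∈ sineSurface) : hor ⟨point z y, h⟩ = z := by
  apply Complex.ext <;> simp [hor, point]

theorem height_mk {z : ℂ} {y : ℝ} (h : point z y ∈ sineSurface) : height ⟨point z y, h⟩ = y := by
  simp [height, point]

theorem ext_hor {x x' : sineSurface} (h : hor x = hor x') (h' : height x = height x') : x = x' :=
  Subtype.ext (by rw [← point_hor_height x, ← point_hor_height x', h, h'])

theorem coordinates (x : sineSurface) :
    (0 < ‖hor x‖ ∧ ‖hor x‖ ≤ 1 ∧ height x = Real.sin (1 / ‖hor x‖)) ∨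
      (hor x = 0 ∧ height x ∈ Icc (-1 : ℝ) 1) := by
  obtain ⟨q, hq⟩ := x
  have hq' := hq
  obtain ⟨θ, p, hp, hθ⟩ := hq'
  have hpp : p = point (p 0 : ℝ) (p 1) := by
    have : p 2 = 0 := by rcases hp with h | h; exacts [h.1, h.2.2]
    ext i
    fin_cases i <;> simp [point, this]
  have e : q = point (p 0 * Complex.exp (θ * Complex.I)) (p 1) := by
    rw [← hθ]
    conv_lhs => rw [hpp, rotateY_point]
  subst e
  rw [hor_mk, height_mk]
  have h3 : ‖(p 0 : ℂ) * Complex.exp (θ * Complex.I)‖ = |p 0| := by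
    rw [norm_mul, Complex.norm_exp_ofReal_mul_I, mul_one, Complex.norm_real, Real.norm_eq_abs]
  rw [h3]
  rcases hp with ⟨-, h, h', h''⟩ | ⟨h, h', -⟩
  · rw [abs_of_pos h]
    exact Or.inl ⟨h, h', h''⟩
  · exact Or.inr ⟨by simp [h], h'⟩

theorem norm_hor_le_one (x : sineSurface) : ‖hor x‖ ≤ 1 := by
  rcases coordinates x with h | h
  · exact h.2.1
  · simp [h.1]

theorem height_eq {x : sineSurface} (h : hor x ≠ 0) : height x = Real.sin (1 / ‖hor x‖) := by
  rcases coordinates x with h' | h'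
  · exact h'.2.2
  · exact (h h'.1).elim

theorem height_mem (x : sineSurface) : height x ∈ Icc (-1 : ℝ) 1 := by
  rcases coordinates x with h | h
  · rw [h.2.2]
    exact Real.sin_mem_Icc _
  · exact h.2

/-- The point of the axis of revolution at height `y`. -/
def axisPoint (y : Icc (-1 : ℝ) 1) : sineSurface := ⟨point 0 y, point_zero_mem y.2⟩

theorem continuous_axisPoint : Continuous axisPoint :=
  (continuous_point continuous_const continuous_subtype_val).subtype_mk _

/-- The point at distance `s` from the axis in the horizontal direction `w`. -/
def polar (w : Circle) (s : Ioc (0 : ℝ) 1) : sineSurface :=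
  ⟨point (s * w) (Real.sin (1 / s)), by
    have h : ‖((s : ℝ) : ℂ) * w‖ = s := by
      rw [norm_mul, Circle.norm_coe, mul_one, Complex.norm_real, Real.norm_of_nonneg s.2.1.le]
    have := point_mem_of_pos (z := ((s : ℝ) : ℂ) * w) (by rw [h]; exact s.2.1)
      (by rw [h]; exact s.2.2)
    rwa [h] at this⟩

theorem hor_polar (w : Circle) (s : Ioc (0 : ℝ) 1) : hor (polar w s) = s * w := hor_mk _

theorem continuous_polar {T : Type*} [TopologicalSpace T] {w : T → Circle} {s : T → Ioc (0 : ℝ) 1}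
    (hw : Continuous w) (hs : Continuous s) : Continuous fun t => polar (w t) (s t) := by
  have hs' : Continuous fun t => (s t : ℝ) := continuous_subtype_val.comp hs
  refine (continuous_point ?_ ?_).subtype_mk _
  · exact (Complex.continuous_ofReal.comp hs').mul (continuous_subtype_val.comp hw)
  · exact Real.continuous_sin.comp (continuous_const.div hs' fun t => (s t).2.1.ne')

theorem eq_of_hor_eq {x x' : sineSurface} (h : hor x = hor x') (h0 : hor x ≠ 0) : x = x' :=
  ext_hor h (by rw [height_eq h0, height_eq (h ▸ h0), h])

theorem polar_eq {x : sineSurface} (h : hor x ≠ 0) {w : Circle} {s : Ioc (0 : ℝ) 1}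
    (hw : s * (w : ℂ) = hor x) : polar w s = x :=
  (eq_of_hor_eq (by rw [hor_polar, hw]) h).symm

/-! ### Triviality of maps of the surface into geometric realizations -/

theorem norm_hor_eq_dist (x : sineSurface) :
    dist x (axisPoint ⟨height x, height_mem x⟩) = ‖hor x‖ := by
  rw [Subtype.dist_eq, EuclideanSpace.dist_eq, ← point_hor_height x, axisPoint,
    Complex.norm_def, Complex.normSq_apply]
  simp [Fin.sum_univ_three, point, Real.dist_eq, sq]

/-- The deformation of the surface, from a map that moves every point along its meridian to a
point at distance at most `ρ` from the axis to the identity. -/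
theorem exists_deformation {ρ : ℝ} (hρ : 0 < ρ) :
    ∃ F : unitInterval × sineSurface → sineSurface, Continuous F ∧ (∀ x, F (1, x) = x) ∧
      ∀ x, ‖hor (F (0, x))‖ ≤ ρ := by
  let r : sineSurface → ℝ := fun x => max ‖hor x‖ ρ
  let s : unitInterval × sineSurface → ℝ := fun z => (1 - (z.1 : ℝ)) * ρ + z.1 * r z.2
  have hr : Continuous r := continuous_hor.norm.max continuous_const
  have hs : Continuous s := by fun_prop
  have hr0 : ∀ x, 0 < r x := fun x => lt_max_of_lt_right hρ
  have hsρ : ∀ z, ρ ≤ s z := fun z => by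
    have h1 : ρ ≤ r z.2 := le_max_right _ _
    have h2 := z.1.2.1
    simp only [s]
    nlinarith
  have hsr : ∀ z, s z ≤ r z.2 := fun z => by
    have h1 : ρ ≤ r z.2 := le_max_right _ _
    have h2 := z.1.2.2
    simp only [s]
    nlinarith
  have hs0 : ∀ z, 0 < s z := fun z => hρ.trans_le (hsρ z)
  let G : unitInterval × sineSurface → EuclideanSpace ℝ (Fin 3) := fun z =>
    if ‖hor z.2‖ ≤ ρ then z.2.1 else
      point (((s z / r z.2 : ℝ) : ℂ) * hor z.2) (Real.sin (1 / s z))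
  have hnorm : ∀ z : unitInterval × sineSurface, ρ < ‖hor z.2‖ →
      ‖((s z / r z.2 : ℝ) : ℂ) * hor z.2‖ = s z := fun z hz => by
    rw [norm_mul, Complex.norm_real, Real.norm_of_nonneg (div_pos (hs0 z) (hr0 z.2)).le,
      show ‖hor z.2‖ = r z.2 from (max_eq_left hz.le).symm, div_mul_cancel₀ _ (hr0 z.2).ne']
  have hG : ∀ z, G z ∈ sineSurface := fun z => by
    simp only [G]
    split_ifs with h
    · exact z.2.2
    · push Not at h
      have := point_mem_of_pos (by rw [hnorm z h]; exact hs0 z) (by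
        rw [hnorm z h]
        refine (hsr z).trans ?_
        rw [show r z.2 = ‖hor z.2‖ from max_eq_left h.le]
        exact norm_hor_le_one _)
      rwa [hnorm z h] at this
  have hor_G : ∀ z, ρ < ‖hor z.2‖ → hor ⟨G z, hG z⟩ = ((s z / r z.2 : ℝ) : ℂ) * hor z.2 := by
    intro z hz
    simp only [G, if_neg (not_le.2 hz)]
    exact hor_mk _
  have hcont : Continuous G := by
    refine Continuous.if_le (by fun_prop) (continuous_point ?_ ?_)
      (continuous_hor.norm.comp continuous_snd) continuous_const fun z hz => ?_
    · refine (Complex.continuous_ofReal.comp ?_).mul (continuous_hor.comp continuous_snd)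
      exact hs.div (hr.comp continuous_snd) fun z => (hr0 _).ne'
    · exact Real.continuous_sin.comp (continuous_const.div hs fun z => (hs0 z).ne')
    · have hr' : r z.2 = ρ := by simp [r, hz]
      have hs' : s z = ρ := by simp only [s, hr']; ring
      rw [hr', hs', div_self hρ.ne', Complex.ofReal_one, one_mul, ← hz, ← height_eq,
        point_hor_height]
      rw [← norm_pos_iff, hz]
      exact hρ
  refine ⟨fun z => ⟨G z, hG z⟩, hcont.subtype_mk _, fun x => ?_, fun x => ?_⟩
  · by_cases h : ‖hor x‖ ≤ ρ
    · exact Subtype.ext (by simp only [G, if_pos h])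
    · push Not at h
      have e : hor ⟨G (1, x), hG (1, x)⟩ = hor x := by
        rw [hor_G (1, x) h]
        have : s (1, x) = r x := by simp [s]
        rw [this, div_self (hr0 x).ne', Complex.ofReal_one, one_mul]
      exact (eq_of_hor_eq e.symm (norm_pos_iff.1 (hρ.trans h))).symm
  · change ‖hor ⟨G (0, x), hG (0, x)⟩‖ ≤ ρ
    by_cases h : ‖hor x‖ ≤ ρ
    · have e : (⟨G (0, x), hG (0, x)⟩ : sineSurface) = x :=
        Subtype.ext (by simp only [G, if_pos h])
      rw [e]
      exact h
    · push Not at h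
      rw [hor_G (0, x) h, hnorm (0, x) h]
      simp [s]

theorem hasFlatFamily {ι : Type*} {K : PreAbstractSimplicialComplex ι}
    (p : C(sineSurface, Realization K)) : HasFlatFamily p := by
  let A : unitInterval × sineSurface → sineSurface := fun z =>
    axisPoint ⟨z.1 * height z.2, by
      have h1 := height_mem z.2
      have h2 := z.1.2
      rw [mem_Icc] at h1 h2 ⊢
      constructor <;> nlinarith⟩
  have hA : Continuous A := continuous_axisPoint.comp (Continuous.subtype_mk
    ((continuous_subtype_val.comp continuous_fst).mul (continuous_height.comp continuous_snd)) _)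
  have hproj : HasFlatFamily fun x => p (A (1, x)) := by
    refine HasFlatFamily.of_homotopy (F := fun z => p (A z)) (p.continuous.comp hA) ?_
    have h0 : (fun x => p (A (0, x))) = fun _ => p (axisPoint ⟨0, by simp⟩) := by simp [A]
    rw [h0]
    exact hasFlatFamily_const _
  have hA1 : ∀ x, A (1, x) = axisPoint ⟨height x, height_mem x⟩ := fun x => by simp [A]
  obtain ⟨δ, hδ, hleb⟩ := lebesgue_number_lemma_of_metric
    (isCompact_range continuous_axisPoint)
    (fun x : sineSurface => (isOpen_star (p x)).preimage p.continuous)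
    (fun x _ => mem_iUnion.2 ⟨x, mem_star_self _⟩)
  obtain ⟨F, hF, hF1, hF0⟩ := exists_deformation (half_pos hδ)
  have hD : Continuous fun x => F (0, x) := by fun_prop
  have hA1c : Continuous fun x => A (1, x) := by fun_prop
  have h0 : HasFlatFamily fun x => p (F (0, x)) := by
    refine (hproj.comp hD).of_contiguous ((p.continuous.comp hA1c).comp hD)
      (p.continuous.comp hD) fun x => ?_
    obtain ⟨y, hy⟩ := hleb (A (1, F (0, x))) ⟨_, rfl⟩
    refine ⟨p y, hy (Metric.mem_ball_self hδ), hy ?_⟩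
    rw [Metric.mem_ball, hA1, norm_hor_eq_dist]
    linarith [hF0 x]
  have h1 := h0.of_homotopy (F := fun z => p (F z)) (p.continuous.comp hF)
  simpa only [hF1] using h1

theorem subsingleton_shapeGroup (x₀ : sineSurface) : Subsingleton (shapeGroup x₀) :=
  ⟨fun g g' => Subtype.ext (funext fun 𝒰 =>
    (𝒰.eq_one_of_hasFlatFamily (hasFlatFamily _) g).trans
      (𝒰.eq_one_of_hasFlatFamily (hasFlatFamily _) g').symm)⟩

end SineSurface

end

noncomputable section

/-- A continuous curve that starts on the graph of `sin (1 / x)`, `x > 0`, does not reach the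
`y`-axis. -/
theorem pos_of_eq_sin_one_div {f g : ℝ → ℝ} (hf : Continuous f) (hg : Continuous g)
    (h0 : ∀ t, 0 ≤ f t) (hfg : ∀ t, 0 < f t → g t = Real.sin (1 / f t)) (h : 0 < f 0) {t : ℝ}
    (ht : 0 ≤ t) : 0 < f t := by
  by_contra hn
  have hft : f t = 0 := le_antisymm (not_lt.1 hn) (h0 t)
  obtain ⟨u, ⟨⟨hu0, -⟩, hu⟩, hleast⟩ :=
    ((isCompact_Icc (a := 0) (b := t)).inter_right (isClosed_singleton.preimage hf)).exists_isLeast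
      ⟨t, ⟨ht, le_rfl⟩, hft⟩
  rw [mem_preimage, mem_singleton_iff] at hu
  have hu0' : 0 < u := lt_of_le_of_ne hu0 fun e => by rw [← e] at hu; linarith
  obtain ⟨δ, hδ, hd⟩ := Metric.continuousAt_iff.1 (hg.continuousAt (x := u)) 1 one_pos
  obtain ⟨v, hv1, hv2⟩ := exists_between (max_lt hu0' (sub_lt_self u hδ))
  rw [max_lt_iff] at hv1
  have hfv : 0 < f v := lt_of_le_of_ne (h0 v) fun e => by
    have hvt : v ≤ t := hv2.le.trans ((hleast ⟨⟨ht, le_rfl⟩, hft⟩))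
    exact absurd (hleast ⟨⟨hv1.1.le, hvt⟩, e.symm⟩) (not_le.2 hv2)
  have key : ∀ c : ℝ, 1 / f v ≤ c → |g u - Real.sin c| < 1 := fun c hc => by
    have hc0 : 0 < c := (one_div_pos.2 hfv).trans_le hc
    have hc1 : 1 / c ≤ f v := by rwa [one_div_le hc0 hfv]
    obtain ⟨w, hw, hwc⟩ := intermediate_value_Icc' hv2.le hf.continuousOn
      (show 1 / c ∈ Icc (f u) (f v) from ⟨by rw [hu]; exact (one_div_pos.2 hc0).le, hc1⟩)
    have := hd (x := w) (by rw [Real.dist_eq, abs_lt]; constructor <;> linarith [hw.1, hw.2])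
    rw [hfg w (by rw [hwc]; exact one_div_pos.2 hc0), hwc, one_div_one_div] at this
    rwa [dist_comm, Real.dist_eq] at this
  obtain ⟨n, hn⟩ := exists_nat_ge (1 / f v)
  have hpi := Real.pi_gt_three
  have hn0 : (0 : ℝ) ≤ n := n.cast_nonneg
  have e1 := key (Real.pi / 2 + n * (2 * Real.pi)) (by nlinarith)
  have e2 := key (3 * Real.pi / 2 + n * (2 * Real.pi)) (by nlinarith)
  rw [Real.sin_add_nat_mul_two_pi, Real.sin_pi_div_two, abs_lt] at e1
  rw [Real.sin_add_nat_mul_two_pi, show 3 * Real.pi / 2 = Real.pi / 2 + Real.pi by ring,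
    Real.sin_add_pi, Real.sin_pi_div_two, abs_lt] at e2
  linarith [e1.1, e2.2]

namespace SineSurface

instance contractibleSpace_unitInterval : ContractibleSpace unitInterval :=
  (convex_Icc (0 : ℝ) 1).contractibleSpace ⟨0, by simp⟩

theorem hor_ne_zero_of_path {x x' : sineSurface} (γ : Path x x') (h : hor x ≠ 0) : hor x' ≠ 0 := by
  have key := pos_of_eq_sin_one_div (f := fun t => ‖hor (γ.extend t)‖)
    (g := fun t => height (γ.extend t)) (continuous_hor.comp γ.continuous_extend).norm
    (continuous_height.comp γ.continuous_extend) (fun t => norm_nonneg _)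
    (fun t ht => height_eq (norm_pos_iff.1 ht)) (by simpa using h) zero_le_one
  simpa using key

theorem hor_ne_zero_of_continuous {T : Type*} [TopologicalSpace T] [PathConnectedSpace T]
    {G : T → sineSurface} (hG : Continuous G) {t₀ : T} (h : hor (G t₀) ≠ 0) (t : T) :
    hor (G t) ≠ 0 :=
  hor_ne_zero_of_path ((PathConnectedSpace.somePath t₀ t).map hG) h

/-! ### The surface is homotopically Hausdorff -/

/-- The distance from the axis, as a radius for `polar`. -/
def radius (x : sineSurface) (h : hor x ≠ 0) : Ioc (0 : ℝ) 1 :=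
  ⟨‖hor x‖, norm_pos_iff.2 h, norm_hor_le_one x⟩

/-- Affine interpolation of radii. -/
def mix (t : unitInterval) (r s : Ioc (0 : ℝ) 1) : Ioc (0 : ℝ) 1 :=
  ⟨(1 - (t : ℝ)) * r + t * s, by
    have h0 := t.2.1
    have h1 := t.2.2
    have hr := r.2
    have hs := s.2
    rw [mem_Ioc] at hr hs ⊢
    constructor
    · rcases h0.eq_or_lt with h | h
      · rw [← h]; linarith
      · nlinarith
    · nlinarith⟩

theorem continuous_mix {T : Type*} [TopologicalSpace T] {t : T → unitInterval}
    {r s : T → Ioc (0 : ℝ) 1} (ht : Continuous t) (hr : Continuous r) (hs : Continuous s) :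
    Continuous fun x => mix (t x) (r x) (s x) :=
  Continuous.subtype_mk (by fun_prop) _

theorem mix_zero (r s : Ioc (0 : ℝ) 1) : mix 0 r s = r := Subtype.ext (by simp [mix])

theorem mix_one (r s : Ioc (0 : ℝ) 1) : mix 1 r s = s := Subtype.ext (by simp [mix])

theorem mix_self (t : unitInterval) (r : Ioc (0 : ℝ) 1) : mix t r r = r :=
  Subtype.ext (by simp only [mix]; ring)

/-- The horizontal direction of a nonzero complex number. -/
def direction (z : ℂ) (h : z ≠ 0) : Circle :=
  ⟨z / ‖z‖, mem_sphere_zero_iff_norm.2 (by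
    rw [norm_div, Complex.norm_real, norm_norm, div_self (norm_ne_zero_iff.2 h)])⟩

theorem norm_mul_direction (z : ℂ) (h : z ≠ 0) : (‖z‖ : ℂ) * direction z h = z :=
  mul_div_cancel₀ _ (by simpa using h)

theorem continuous_direction {T : Type*} [TopologicalSpace T] {z : T → ℂ} (hz : Continuous z)
    (h : ∀ t, z t ≠ 0) : Continuous fun t => direction (z t) (h t) :=
  Continuous.subtype_mk (hz.div (Complex.continuous_ofReal.comp hz.norm)
    fun t => by simpa using h t) _

theorem fromPath_eq_one {Y : Type*} [TopologicalSpace Y] {y : Y} {α : Path y y}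
    {F : unitInterval × unitInterval → Y} (hF : Continuous F) (h0 : ∀ t, F (0, t) = α t)
    (h1 : ∀ t, F (1, t) = y) (hl : ∀ s, F (s, 0) = y) (hr : ∀ s, F (s, 1) = y) :
    FundamentalGroup.fromPath (.mk α) = 1 := by
  refine Path.Homotopic.Quotient.eq.2 ⟨{
    toFun := F
    continuous_toFun := hF
    map_zero_left := h0
    map_one_left := h1
    prop' := ?_ }⟩
  rintro s t (rfl | rfl)
  · exact (hl s).trans α.source.symm
  · exact (hr s).trans α.target.symm

theorem homotopicallyHausdorffAt_of_hor_eq_zero {x : sineSurface} (h : hor x = 0) :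
    HomotopicallyHausdorffAt x := by
  intro g hg
  refine ⟨univ, isOpen_univ, mem_univ x, ?_⟩
  rintro ⟨α, -, rfl⟩
  refine hg ?_
  have hα : ∀ t, hor (α t) = 0 := fun t => by
    by_contra ht
    exact hor_ne_zero_of_continuous α.continuous ht 0 (by rwa [α.source])
  have hax : ∀ {x' : sineSurface} {y : Icc (-1 : ℝ) 1}, hor x' = 0 → (y : ℝ) = height x' →
      axisPoint y = x' := fun {x' y} h h' =>
    ext_hor (by rw [h]; exact hor_mk _) ((height_mk _).trans h')
  let F : unitInterval × unitInterval → sineSurface := fun z =>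
    axisPoint ⟨(1 - (z.1 : ℝ)) * height (α z.2) + z.1 * height x,
      (convex_Icc (-1 : ℝ) 1) (height_mem _) (height_mem _) (sub_nonneg.2 z.1.2.2) z.1.2.1
        (sub_add_cancel _ _)⟩
  have hF : Continuous F := continuous_axisPoint.comp (Continuous.subtype_mk (by
    have := continuous_height.comp (α.continuous.comp (continuous_snd (X := unitInterval)))
    have h2 : Continuous fun z : unitInterval × unitInterval => (z.1 : ℝ) := by fun_prop
    exact ((continuous_const.sub h2).mul this).add (h2.mul continuous_const)) _)
  refine fromPath_eq_one hF (fun t => hax (hα t) ?_) (fun t => hax h ?_) (fun s => hax h ?_)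
    (fun s => hax h ?_)
  · simp
  · simp
  · simp only [α.source]; ring
  · simp only [α.target]; ring

theorem homotopicallyHausdorffAt_of_hor_ne_zero {x : sineSurface} (h : hor x ≠ 0) :
    HomotopicallyHausdorffAt x := by
  intro g hg
  refine ⟨{x' | 0 < (hor x' / hor x).re}, ?_, ?_, ?_⟩
  · exact isOpen_lt continuous_const (Complex.continuous_re.comp
      (continuous_hor.div_const _))
  · simp [div_self h]
  rintro ⟨α, hα, rfl⟩
  refine hg ?_
  have hα0 : ∀ t, hor (α t) ≠ 0 := hor_ne_zero_of_continuous α.continuous (t₀ := 0)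
    (by rwa [α.source])
  let θ : unitInterval → ℝ := fun t => (hor (α t) / hor x).arg
  have hθ : Continuous θ := continuous_iff_continuousAt.2 fun t =>
    ContinuousAt.comp (f := fun t => hor (α t) / hor x)
      (Complex.continuousAt_arg (Or.inl (hα t)))
      ((continuous_hor.comp α.continuous).div_const _).continuousAt
  have hr : Continuous fun t => radius (α t) (hα0 t) :=
    (continuous_hor.comp α.continuous).norm.subtype_mk _
  let F : unitInterval × unitInterval → sineSurface := fun z =>
    polar (direction (hor x) h * Circle.exp ((1 - (z.1 : ℝ)) * θ z.2))
      (mix z.1 (radius (α z.2) (hα0 z.2)) (radius x h))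
  have hF : Continuous F := by
    refine continuous_polar ?_ ?_
    · fun_prop
    · exact continuous_mix continuous_fst (hr.comp continuous_snd) continuous_const
  have hbase : polar (direction (hor x) h * Circle.exp 0) (radius x h) = x :=
    polar_eq h (by rw [Circle.exp_zero, mul_one]; exact norm_mul_direction _ h)
  have hend : ∀ t, α t = x → ∀ s, F (s, t) = x := fun t ht s => by
    have h1 : θ t = 0 := by simp [θ, ht, div_self h]
    have h2 : radius (α t) (hα0 t) = radius x h := Subtype.ext (by simp [radius, ht])
    simp only [F]
    rw [h1, h2, mix_self, mul_zero, hbase]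
  refine fromPath_eq_one hF (fun t => ?_) (fun t => ?_) (hend 0 α.source) (hend 1 α.target)
  · simp only [F, Icc.coe_zero, sub_zero, one_mul]
    refine polar_eq (hα0 t) ?_
    rw [mix_zero, Circle.coe_mul, Circle.coe_exp]
    change (‖hor (α t)‖ : ℂ) * (hor x / ‖hor x‖ * Complex.exp (θ t * Complex.I)) = hor (α t)
    have e := Complex.norm_mul_exp_arg_mul_I (hor (α t) / hor x)
    rw [norm_div, Complex.ofReal_div] at e
    have hx : (‖hor x‖ : ℂ) ≠ 0 := by simpa using h
    calc _ = hor x * (‖hor (α t)‖ / ‖hor x‖ * Complex.exp (θ t * Complex.I)) := by ring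
      _ = hor (α t) := by rw [e, mul_div_cancel₀ _ h]
  · simp only [F, Icc.coe_one, sub_self, zero_mul]
    rw [mix_one, hbase]

theorem homotopicallyHausdorff : HomotopicallyHausdorff sineSurface := fun x => by
  by_cases h : hor x = 0
  · exact homotopicallyHausdorffAt_of_hor_eq_zero h
  · exact homotopicallyHausdorffAt_of_hor_ne_zero h

/-! ### The fundamental group of the surface -/

/-- The boundary circle of the surface. -/
def rim : C(Circle, sineSurface) :=
  ⟨fun w => polar w ⟨1, by norm_num, le_rfl⟩, continuous_polar continuous_id continuous_const⟩

theorem hor_rim (w : Circle) : hor (rim w) = w := by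
  refine (hor_polar _ _).trans ?_
  simp

theorem hor_rim_ne_zero (w : Circle) : hor (rim w) ≠ 0 := by
  rw [hor_rim]
  exact Circle.coe_ne_zero w

theorem hor_sineBase : hor sineBase = 1 := by
  simp [hor, sineBase]

theorem rim_one : rim 1 = sineBase :=
  eq_of_hor_eq (by rw [hor_rim, hor_sineBase, Circle.coe_one]) (hor_rim_ne_zero 1)

theorem direction_rim (w : Circle) (h : hor (rim w) ≠ 0) : direction (hor (rim w)) h = w := by
  ext
  change hor (rim w) / ‖hor (rim w)‖ = w
  rw [hor_rim, Circle.norm_coe, Complex.ofReal_one, div_one]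

theorem direction_sineBase (h : hor sineBase ≠ 0) : direction (hor sineBase) h = 1 := by
  ext
  change hor sineBase / ‖hor sineBase‖ = 1
  simp [hor_sineBase]

theorem rim_injective : Function.Injective (FundamentalGroup.mapOfEq rim rim_one) := by
  rw [injective_iff_map_eq_one]
  intro g hg
  induction g using Path.Homotopic.Quotient.ind with
  | mk γ =>
    rw [FundamentalGroup.mapOfEq_apply, ← Path.Homotopic.Quotient.mk_map,
      ← Path.Homotopic.Quotient.mk_cast] at hg
    obtain ⟨F⟩ := Path.Homotopic.Quotient.eq.1
      (hg.trans (Path.Homotopic.Quotient.mk_refl sineBase).symm)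
    have hF0 : ∀ t, F (0, t) = rim (γ t) := fun t => F.apply_zero t
    have hF1 : ∀ t, F (1, t) = sineBase := fun t => F.apply_one t
    have hne : ∀ z, hor (F z) ≠ 0 := hor_ne_zero_of_continuous F.continuous (t₀ := (0, 0))
      (by rw [hF0]; exact hor_rim_ne_zero _)
    refine fromPath_eq_one (F := fun z => direction (hor (F z)) (hne z))
      (continuous_direction (continuous_hor.comp F.continuous) hne) (fun t => ?_) (fun t => ?_)
      (fun s => ?_) (fun s => ?_)
    · simp only [hF0, direction_rim]
    · simp only [hF1, direction_sineBase]
    · simp only [F.source, direction_sineBase]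
    · simp only [F.target, direction_sineBase]

theorem rim_surjective : Function.Surjective (FundamentalGroup.mapOfEq rim rim_one) := by
  intro g
  induction g using Path.Homotopic.Quotient.ind with
  | mk β =>
    have hb : hor sineBase ≠ 0 := by rw [hor_sineBase]; exact one_ne_zero
    have hne : ∀ t, hor (β t) ≠ 0 := hor_ne_zero_of_continuous β.continuous (t₀ := 0)
      (by rwa [β.source])
    have hdir : Continuous fun t => direction (hor (β t)) (hne t) :=
      continuous_direction (continuous_hor.comp β.continuous) hne
    have hr : Continuous fun t => radius (β t) (hne t) :=
      (continuous_hor.comp β.continuous).norm.subtype_mk _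
    let γ : Path (1 : Circle) 1 :=
      { toFun := fun t => direction (hor (β t)) (hne t)
        continuous_toFun := hdir
        source' := by simp only [β.source, direction_sineBase]
        target' := by simp only [β.target, direction_sineBase] }
    refine ⟨FundamentalGroup.fromPath (.mk γ), ?_⟩
    rw [FundamentalGroup.mapOfEq_apply, ← Path.Homotopic.Quotient.mk_map,
      ← Path.Homotopic.Quotient.mk_cast]
    symm
    let F : unitInterval × unitInterval → sineSurface := fun z =>
      polar (direction (hor (β z.2)) (hne z.2))
        (mix z.1 (radius (β z.2) (hne z.2)) ⟨1, by norm_num, le_rfl⟩)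
    have hF : Continuous F := continuous_polar (hdir.comp continuous_snd)
      (continuous_mix continuous_fst (hr.comp continuous_snd) continuous_const)
    have hend : ∀ t, β t = sineBase → ∀ s, F (s, t) = β t := fun t ht s => by
      refine polar_eq (hne t) ?_
      have h2 : radius (β t) (hne t) = ⟨1, by norm_num, le_rfl⟩ :=
        Subtype.ext (by simp [radius, ht, hor_sineBase])
      rw [← h2, mix_self]
      exact norm_mul_direction _ _
    refine Path.Homotopic.Quotient.eq.2 ⟨{
      toFun := F
      continuous_toFun := hF
      map_zero_left := fun t => polar_eq (hne t) ?_
      map_one_left := fun t => ?_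
      prop' := ?_ }⟩
    · simp only [mix_zero]
      exact norm_mul_direction _ _
    · simp only [F, mix_one]
      rfl
    · rintro s t (rfl | rfl)
      · exact hend 0 β.source s
      · exact hend 1 β.target s

theorem nonempty_fundamentalGroup_circle_mulEquiv :
    Nonempty (FundamentalGroup Circle 1 ≃* Multiplicative ℤ) := by
  have hinj : Function.Injective fun n : ℤ =>
      (⟨n • (2 * Real.pi), n, rfl⟩ : AddSubgroup.zmultiples (2 * Real.pi)) := fun m n h => by
    have h' : (m : ℝ) * (2 * Real.pi) = n * (2 * Real.pi) := by
      simpa using congrArg Subtype.val h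
    exact_mod_cast mul_right_cancel₀ (by positivity) h'
  let f : ℤ →+ AddSubgroup.zmultiples (2 * Real.pi) :=
    AddMonoidHom.mk' (fun n => ⟨n • (2 * Real.pi), n, rfl⟩)
      fun m n => Subtype.ext (add_zsmul _ _ _)
  let e : ℤ ≃+ AddSubgroup.zmultiples (2 * Real.pi) :=
    AddEquiv.ofBijective f ⟨hinj, fun ⟨_, n, hn⟩ => ⟨n, Subtype.ext hn⟩⟩
  exact ⟨(Circle.isAddQuotientCoveringMap_exp.fundamentalGroupEquiv ⟨0, by simp⟩).trans
    (MulOpposite.opMulEquiv.symm.trans (AddEquiv.toMultiplicative e).symm)⟩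

theorem nonempty_fundamentalGroup_mulEquiv :
    Nonempty (FundamentalGroup sineSurface sineBase ≃* Multiplicative ℤ) :=
  nonempty_fundamentalGroup_circle_mulEquiv.map fun e =>
    (MulEquiv.ofBijective _ ⟨rim_injective, rim_surjective⟩).symm.trans e

end SineSurface

end

theorem mainTheorem7 :
    (∀ (X : Type u) [TopologicalSpace X] (x₀ : X),
      Function.Injective (naturalHom x₀) → HomotopicallyHausdorffAt x₀) ∧
    (HomotopicallyHausdorff sineSurface ∧
      Nonempty (FundamentalGroup sineSurface sineBase ≃* Multiplicative ℤ) ∧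
      Subsingleton (shapeGroup sineBase) ∧
      ¬ Function.Injective (naturalHom sineBase)) := by
  refine ⟨fun X _ x₀ h => PointedNormalCover.homotopicallyHausdorffAt_of_injective h,
    SineSurface.homotopicallyHausdorff, SineSurface.nonempty_fundamentalGroup_mulEquiv,
    SineSurface.subsingleton_shapeGroup _, fun h => ?_⟩
  obtain ⟨e⟩ := SineSurface.nonempty_fundamentalGroup_mulEquiv
  have := SineSurface.subsingleton_shapeGroup sineBase
  have := h.subsingleton
  exact not_subsingleton (Multiplicative ℤ) e.symm.injective.subsingleton
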